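/- Let $R$ be a commutative ring and let $C$ be a semidualizing $R$-module, i.e. $C$ has a projective resolution by finitely generated projective modules, the homothety map $R\to\operatorname{Hom}_R(C,C)$ is an isomorphism, and $\operatorname{Ext}_R^i(C,C)=0$ for all $i\ge 1$. Let $\mathcal P_C$ be the class of modules isomorphic to $C\otimes_R P$ with $P$ projective, and $\mathcal I_C$ the class of modules isomorphic to $\operatorname{Hom}_R(C,I)$ with $I$ injective. An augmented proper $\mathcal P_C$-projective resolution of an $R$-module $M$ is a complex $X^+=(\cdots\to X_1\to X_0\to M\to 0)$ with all $X_i\in\mathcal P_C$ such that $\operatorname{Hom}_R(C\otimes_RQ,X^+)$ is exact for every projective $Q$; $X=(\cdots\to X_1\to X_0\to 0)$ is then a proper $\mathcal P_C$-projective resolution of $M$. Dually, an augmented proper $\mathcal I_C$-injective resolution of $N$ is a complex $Y^+=(0\to N\to Y^0\to Y^1\to\cdots)$ with all $Y^i\in\mathcal I_C$ such that $\operatorname{Hom}_R(Y^+,\operatorname{Hom}_R(C,J))$ is exact for every injective $J$. Such resolutions exist for every module, and are unique up to homotopy equivalence. Put $\operatorname{Ext}^n_{\mathcal P_C}(M,N)=H^n\operatorname{Hom}_R(X,N)$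 and $\operatorname{Ext}^n_{\mathcal I_C}(M,N)=H^n\operatorname{Hom}_R(M,Y)$, and $$\mathcal P_C\text{-pd}(M)=\inf_{X}\,\sup\{n\mid X_n\ne0\},\qquad \mathcal I_C\text{-id}(N)=\inf_{Y}\,\sup\{n\mid Y^n\ne0\},$$ the infima being over all proper resolutions of $M$, respectively $N$. Values lie in $\{-\infty\}\cup\mathbb N\cup\{\infty\}$, with $\sup\emptyset=-\infty$ and $\inf\emptyset=\infty$. Let $M$ and $N$ be $R$-modules and $n\ge0$ an integer. Then: 1. $\mathcal P_C\text{-pd}(M)\le n$ if and only if there is an exact sequence $0\to C\otimes_RP_n\to\cdots\to C\otimes_RP_0\to M\to0$ with each $P_i$ projective. 2. $\mathcal I_C\text{-id}(N)\le n$ if and only if there is an exact sequence $0\to N\to\operatorname{Hom}_R(C,I^0)\to\cdots\to\operatorname{Hom}_R(C,I^n)\to0$ with each $I^i$ injective. 3. The following are equivalent: (i) $\operatorname{Ext}^{n+1}_{\mathcal P_C}(M,-)=0$; (ii) $\operatorname{Ext}^{i}_{\mathcal P_C}(M,-)=0$ for all $i\ge n+1$; (iii) $\mathcal P_C\text{-pd}(M)\le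 n$. 4. The following are equivalent: (i) $\operatorname{Ext}^{n+1}_{\mathcal I_C}(-,N)=0$; (ii) $\operatorname{Ext}^{i}_{\mathcal I_C}(-,N)=0$ for all $i\ge n+1$; (iii) $\mathcal I_C\text{-id}(N)\le n$. 5. The following three quantities are equal: $\mathcal P_C\text{-pd}(M)$; the infimum of $\sup\{n\mid X_n\ne0\}$ over those proper $\mathcal P_C$-projective resolutions $X$ of $M$ for which $X^+$ is exact; and $\sup\{n\mid\operatorname{Ext}^n_{\mathcal P_C}(M,-)\ne0\}$. -/

import Mathlib

universe u

namespace CRel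

open CategoryTheory CategoryTheory.Limits Opposite TensorProduct

noncomputable section

variable {R : Type u} [CommRing R]

/-- `C` is a semidualizing `R`-module. -/
structure IsSemidualizing (C : ModuleCat.{u} R) : Prop where
  /-- `C` admits a degreewise finite projective resolution. -/
  finite_resolution : ∃ P : ProjectiveResolution C, ∀ n, Module.Finite R (P.complex.X n)
  /-- The homothety map `R → Hom_R(C, C)` is an isomorphism. -/
  homothety : Function.Bijective (LinearMap.lsmul R C : R →ₗ[R] C →ₗ[R] C)
  /-- `Ext^i_R(C, C) = 0` for all `i ≥ 1`. -/
  ext_self : ∀ i : ℕ, 1 ≤ i → Subsingleton (Abelian.Ext C C i)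

/-- The module `C ⊗_R P`. -/
abbrev tensor (C P : ModuleCat.{u} R) : ModuleCat.{u} R := ModuleCat.of R (C ⊗[R] P)

/-- The module `Hom_R(C, I)`. -/
abbrev hom (C I : ModuleCat.{u} R) : ModuleCat.{u} R := ModuleCat.of R (C →ₗ[R] I)

/-- Membership in the class `𝒫_C`. -/
def IsCProjective (C X : ModuleCat.{u} R) : Prop :=
  ∃ P : ModuleCat.{u} R, Module.Projective R P ∧ Nonempty (X ≅ tensor C P)

/-- Membership in the class `ℐ_C`. -/
def IsCInjective (C X : ModuleCat.{u} R) : Prop :=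
  ∃ I : ModuleCat.{u} R, Module.Injective R I ∧ Nonempty (X ≅ hom C I)

/-- The complex `Hom_R(A, X)`, for a chain or cochain complex `X`. -/
def homFrom {c : ComplexShape ℕ} (A : ModuleCat.{u} R) (X : HomologicalComplex (ModuleCat.{u} R) c) :
    HomologicalComplex (ModuleCat.{u} R) c :=
  (((linearCoyoneda R (ModuleCat.{u} R)).obj (op A)).mapHomologicalComplex c).obj X

/-- The complex `Hom_R(X, B)`, for a chain or cochain complex `X`. The arrows are reversed,
so this is a complex of the opposite shape. -/
def homInto {c : ComplexShape ℕ} (X : HomologicalComplex (ModuleCat.{u} R) c) (B : ModuleCat.{u} R) :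
    HomologicalComplex (ModuleCat.{u} R) c.symm :=
  ((((linearYoneda R (ModuleCat.{u} R)).obj B).rightOp.mapHomologicalComplex c).obj X).unop

/-- A proper `𝒫_C`-projective resolution `X` of `M`, together with its augmentation `X_0 → M`. -/
structure ProperProjRes (C M : ModuleCat.{u} R) where
  /-- The complex `X`. -/
  complex : ChainComplex (ModuleCat.{u} R) ℕ
  /-- The augmentation. -/
  ε : complex.X 0 ⟶ M
  d_ε : complex.d 1 0 ≫ ε = 0
  cproj : ∀ n, IsCProjective C (complex.X n)
  /-- `Hom_R(C ⊗ Q, X⁺)` is exact for every projective `Q`. -/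
  proper : ∀ Q : ModuleCat.{u} R, Module.Projective R Q →
    (homFrom (tensor C Q) (complex.augment ε d_ε)).Acyclic

/-- The augmented resolution `X⁺ = ⋯ → X_1 → X_0 → M → 0`. -/
def ProperProjRes.augmented {C M : ModuleCat.{u} R} (X : ProperProjRes C M) :
    ChainComplex (ModuleCat.{u} R) ℕ :=
  X.complex.augment X.ε X.d_ε

/-- A proper `ℐ_C`-injective resolution `Y` of `N`, together with its augmentation `N → Y^0`. -/
structure ProperInjRes (C N : ModuleCat.{u} R) where
  /-- The complex `Y`. -/
  complex : CochainComplex (ModuleCat.{u} R) ℕ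
  /-- The augmentation. -/
  η : N ⟶ complex.X 0
  η_d : η ≫ complex.d 0 1 = 0
  cinj : ∀ n, IsCInjective C (complex.X n)
  /-- `Hom_R(Y⁺, Hom_R(C, J))` is exact for every injective `J`. -/
  proper : ∀ J : ModuleCat.{u} R, Module.Injective R J →
    (homInto (complex.augment η η_d) (hom C J)).Acyclic

/-- `sup {n | X_n ≠ 0}`, which is `⊥` (that is, `-∞`) for `X = 0`. -/
def length {c : ComplexShape ℕ} (X : HomologicalComplex (ModuleCat.{u} R) c) : WithBot ℕ∞ :=
  ⨆ (n : ℕ) (_ : ¬ IsZero (X.X n)), ((n : ℕ∞) : WithBot ℕ∞)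

/-- The `𝒫_C`-projective dimension of `M`. -/
def projDim (C M : ModuleCat.{u} R) : WithBot ℕ∞ :=
  ⨅ X : ProperProjRes C M, length X.complex

/-- The `ℐ_C`-injective dimension of `N`. -/
def injDim (C N : ModuleCat.{u} R) : WithBot ℕ∞ :=
  ⨅ Y : ProperInjRes C N, length Y.complex

/-- The dimension of `M` computed by the exact augmented proper `𝒫_C`-projective resolutions
only; it is `⊤` if there are none. -/
def exactProjDim (C M : ModuleCat.{u} R) : WithBot ℕ∞ :=
  ⨅ (X : ProperProjRes C M) (_ : X.augmented.Acyclic), length X.complex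

/-- There is an exact sequence `0 → C ⊗ P_n → ⋯ → C ⊗ P_0 → M → 0` with all `P_i` projective. -/
def HasProjSequence (C M : ModuleCat.{u} R) (n : ℕ) : Prop :=
  ∃ (X : ChainComplex (ModuleCat.{u} R) ℕ) (ε : X.X 0 ⟶ M) (w : X.d 1 0 ≫ ε = 0),
    (X.augment ε w).Acyclic ∧ (∀ i ≤ n, IsCProjective C (X.X i)) ∧ ∀ i, n < i → IsZero (X.X i)

/-- There is an exact sequence `0 → N → Hom(C, I^0) → ⋯ → Hom(C, I^n) → 0` with all `I^i`
injective. -/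
def HasInjSequence (C N : ModuleCat.{u} R) (n : ℕ) : Prop :=
  ∃ (Y : CochainComplex (ModuleCat.{u} R) ℕ) (η : N ⟶ Y.X 0) (w : η ≫ Y.d 0 1 = 0),
    (Y.augment η w).Acyclic ∧ (∀ i ≤ n, IsCInjective C (Y.X i)) ∧ ∀ i, n < i → IsZero (Y.X i)

/-! ### Exactness of Hom complexes in terms of factorizations -/

/-- Exactness of `Hom(A, Z)` spelled out. -/
def Lifts (A : ModuleCat.{u} R) (Z : ChainComplex (ModuleCat.{u} R) ℕ) : Prop :=
  (∀ f : A ⟶ Z.X 0, ∃ g : A ⟶ Z.X 1, g ≫ Z.d 1 0 = f) ∧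
  ∀ n, ∀ f : A ⟶ Z.X (n + 1), f ≫ Z.d (n + 1) n = 0 → ∃ g : A ⟶ Z.X (n + 2), g ≫ Z.d (n + 2) (n + 1) = f

lemma homFrom_acyclic_iff (A : ModuleCat.{u} R) (Z : ChainComplex (ModuleCat.{u} R) ℕ) :
    (homFrom A Z).Acyclic ↔ Lifts A Z := by
  have key : ∀ i j k, (ComplexShape.down ℕ).prev j = i → (ComplexShape.down ℕ).next j = k →
      ((homFrom A Z).ExactAt j ↔
        ∀ f : A ⟶ Z.X j, f ≫ Z.d j k = 0 → ∃ g : A ⟶ Z.X i, g ≫ Z.d i j = f) := by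
    intro i j k hi hk
    rw [HomologicalComplex.exactAt_iff' _ i j k hi hk, ShortComplex.moduleCat_exact_iff]
    rfl
  constructor
  · intro h
    refine ⟨fun f => (key 1 0 0 (by simp) (by simp)).1 (h 0) f ?_, fun n f hf =>
      (key (n + 2) (n + 1) n (by simp) (by simp)).1 (h (n + 1)) f hf⟩
    rw [Z.shape 0 0 (by simp), comp_zero]
  · rintro ⟨h0, h1⟩ (_ | n)
    · exact (key 1 0 0 (by simp) (by simp)).2 fun f _ => h0 f
    · exact (key (n + 2) (n + 1) n (by simp) (by simp)).2 (h1 n)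

/-- Exactness of `Hom(Z, B)` spelled out. -/
def Extends (Z : CochainComplex (ModuleCat.{u} R) ℕ) (B : ModuleCat.{u} R) : Prop :=
  (∀ f : Z.X 0 ⟶ B, ∃ g : Z.X 1 ⟶ B, Z.d 0 1 ≫ g = f) ∧
  ∀ n, ∀ f : Z.X (n + 1) ⟶ B, Z.d n (n + 1) ≫ f = 0 → ∃ g : Z.X (n + 2) ⟶ B, Z.d (n + 1) (n + 2) ≫ g = f

lemma homInto_acyclic_iff (Z : CochainComplex (ModuleCat.{u} R) ℕ) (B : ModuleCat.{u} R) :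
    (homInto Z B).Acyclic ↔ Extends Z B := by
  have key : ∀ i j k, (ComplexShape.up ℕ).next j = i → (ComplexShape.up ℕ).prev j = k →
      ((homInto Z B).ExactAt j ↔
        ∀ f : Z.X j ⟶ B, Z.d k j ≫ f = 0 → ∃ g : Z.X i ⟶ B, Z.d j i ≫ g = f) := by
    intro i j k hi hk
    rw [HomologicalComplex.exactAt_iff' (homInto Z B) i j k (show (ComplexShape.up ℕ).symm.prev j = i from hi)
      (show (ComplexShape.up ℕ).symm.next j = k from hk), ShortComplex.moduleCat_exact_iff]
    rfl
  constructor
  · intro h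
    refine ⟨fun f => (key 1 0 0 (by simp) (by simp)).1 (h 0) f ?_, fun n f hf =>
      (key (n + 2) (n + 1) n (by simp) (by simp)).1 (h (n + 1)) f hf⟩
    rw [Z.shape 0 0 (by simp), zero_comp]
  · rintro ⟨h0, h1⟩ (_ | n)
    · exact (key 1 0 0 (by simp) (by simp)).2 fun f _ => h0 f
    · exact (key (n + 2) (n + 1) n (by simp) (by simp)).2 (h1 n)

/-! ### Existence of proper resolutions -/

lemma exists_precover (C M : ModuleCat.{u} R) :
    ∃ (F : ModuleCat.{u} R) (π : tensor C F ⟶ M), Module.Projective R F ∧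
      ∀ Q : ModuleCat.{u} R, Module.Projective R Q → ∀ f : tensor C Q ⟶ M,
        ∃ g : tensor C Q ⟶ tensor C F, g ≫ π = f := by
  let p : ((C →ₗ[R] M) →₀ R) →ₗ[R] (C →ₗ[R] M) := Finsupp.linearCombination R id
  have hp : Function.Surjective p := Finsupp.linearCombination_id_surjective R _
  refine ⟨ModuleCat.of R ((C →ₗ[R] M) →₀ R),
    ModuleCat.ofHom (TensorProduct.lift p.flip), inferInstance, fun Q hQ f => ?_⟩
  obtain ⟨l, hl⟩ := Module.projective_lifting_property p
    (TensorProduct.curry f.hom).flip hp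
  refine ⟨ModuleCat.ofHom (LinearMap.lTensor C l), ?_⟩
  ext : 1
  refine TensorProduct.ext' fun c q => ?_
  have := congrArg (fun φ => φ q c) hl
  simpa using this

lemma exists_preenvelope (C M : ModuleCat.{u} R) :
    ∃ (I : ModuleCat.{u} R) (ι : M ⟶ hom C I), Module.Injective R I ∧
      ∀ J : ModuleCat.{u} R, Module.Injective R J → ∀ f : M ⟶ hom C J,
        ∃ g : hom C I ⟶ hom C J, ι ≫ g = f := by
  let I : ModuleCat.{u} R := Injective.under (tensor C M)
  have hI : Injective (ModuleCat.of R I) :=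
    inferInstanceAs (Injective (Injective.under (tensor C M)))
  let j : tensor C M ⟶ I := Injective.ι (tensor C M)
  have hj : Function.Injective j.hom := (ModuleCat.mono_iff_injective j).1 inferInstance
  refine ⟨I, ModuleCat.ofHom (TensorProduct.curry j.hom).flip,
    Module.injective_module_of_injective_object (inj := hI) R I, fun J hJ f => ?_⟩
  obtain ⟨h, hh⟩ := hJ.out j.hom hj (TensorProduct.lift f.hom.flip)
  refine ⟨ModuleCat.ofHom (LinearMap.compRight R h), ?_⟩
  ext m c
  simpa using hh (c ⊗ₜ m)

instance nonempty_properProjRes (C M : ModuleCat.{u} R) : Nonempty (ProperProjRes C M) := by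
  choose F π hF hπ using exists_precover (R := R) C
  let s : ∀ {X₀ X₁ : ModuleCat.{u} R} (f : X₁ ⟶ X₀),
      Σ' (X₂ : ModuleCat.{u} R) (d : X₂ ⟶ X₁), d ≫ f = 0 := fun f =>
    ⟨tensor C (F (kernel f)), π (kernel f) ≫ kernel.ι f, by simp⟩
  let Z := ChainComplex.mk' M (tensor C (F M)) (π M) s
  have hZ : ∀ Q : ModuleCat.{u} R, Module.Projective R Q → Lifts (tensor C Q) Z := by
    intro Q hQ
    refine ⟨fun f => ?_, fun n f hf => ?_⟩
    · obtain ⟨g, hg⟩ := hπ M Q hQ f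
      exact ⟨g, (congrArg (g ≫ ·) (ChainComplex.mk'_d_1_0 M (tensor C (F M)) (π M) s)).trans hg⟩
    · obtain ⟨g, hg⟩ := hπ _ Q hQ (kernel.lift (Z.d (n + 1) n) f hf)
      refine ⟨g ≫ (ChainComplex.mk'XIso M (tensor C (F M)) (π M) s n).inv, ?_⟩
      rw [show Z.d (n + 2) (n + 1) = _ from ChainComplex.mk'_d M (tensor C (F M)) (π M) s n,
        Category.assoc, Iso.inv_hom_id_assoc]
      change g ≫ π _ ≫ kernel.ι (Z.d (n + 1) n) = f
      rw [← Category.assoc, hg, kernel.lift_ι]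
  refine ⟨⟨ChainComplex.truncate.obj Z, Z.d 1 0, Z.d_comp_d _ _ _, fun n => ?_, fun Q hQ => ?_⟩⟩
  · rcases n with _ | n
    · exact ⟨F M, hF M, ⟨Iso.refl _⟩⟩
    · exact ⟨_, hF _, ⟨ChainComplex.mk'XIso M (tensor C (F M)) (π M) s n⟩⟩
  · rw [homFrom_acyclic_iff]
    obtain ⟨h0, h1⟩ := hZ Q hQ
    refine ⟨h0, fun n f hf => ?_⟩
    rcases n with _ | n
    · exact h1 0 f hf
    · exact h1 (n + 1) f hf

instance nonempty_properInjRes (C N : ModuleCat.{u} R) : Nonempty (ProperInjRes C N) := by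
  choose I ι hI hι using exists_preenvelope (R := R) C
  let σ : ℕ → Σ (A B : ModuleCat.{u} R), A ⟶ B := fun n =>
    Nat.rec ⟨N, hom C (I N), ι N⟩
      (fun _ s => ⟨s.2.1, hom C (I (cokernel s.2.2)), cokernel.π s.2.2 ≫ ι (cokernel s.2.2)⟩) n
  let d : ∀ n, (σ n).1 ⟶ (σ (n + 1)).1 := fun n => (σ n).2.2
  have hd : ∀ n, d n ≫ d (n + 1) = 0 := fun n => by
    change (σ n).2.2 ≫ cokernel.π (σ n).2.2 ≫ ι (cokernel (σ n).2.2) = 0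
    rw [cokernel.condition_assoc, zero_comp]
  let Z := CochainComplex.of (fun n => (σ n).1) d hd
  have hZd : ∀ n, Z.d n (n + 1) = d n := fun n => CochainComplex.of_d (fun n => (σ n).1) d n
  have hZ : ∀ J : ModuleCat.{u} R, Module.Injective R J → Extends Z (hom C J) := by
    intro J hJ
    refine ⟨fun f => ?_, fun n f hf => ?_⟩
    · obtain ⟨g, hg⟩ := hι N J hJ f
      exact ⟨g, (congrArg (· ≫ g) (hZd 0)).trans hg⟩
    · rw [hZd] at hf
      obtain ⟨g, hg⟩ := hι (cokernel (d n)) J hJ (cokernel.desc (d n) f hf)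
      refine ⟨g, ?_⟩
      rw [hZd]
      change (cokernel.π (d n) ≫ ι (cokernel (d n))) ≫ g = f
      rw [Category.assoc, hg, cokernel.π_desc]
  refine ⟨⟨CochainComplex.truncate.obj Z, Z.d 0 1, Z.d_comp_d _ _ _, fun n => ?_, fun J hJ => ?_⟩⟩
  · rcases n with _ | n
    · exact ⟨I N, hI N, ⟨Iso.refl _⟩⟩
    · exact ⟨I (cokernel (d n)), hI _, ⟨Iso.refl _⟩⟩
  · rw [homInto_acyclic_iff]
    obtain ⟨h0, h1⟩ := hZ J hJ
    refine ⟨h0, fun n f hf => ?_⟩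
    rcases n with _ | n
    · exact h1 0 f hf
    · exact h1 (n + 1) f hf

/-! ### Relative cohomology -/

/-- `Ext^n_{𝒫_C}(M, N) = H^n Hom_R(X, N)` for a proper `𝒫_C`-projective resolution `X` of `M`. -/
def extProj (C M N : ModuleCat.{u} R) (n : ℕ) : ModuleCat.{u} R :=
  (homInto (Classical.arbitrary (ProperProjRes C M)).complex N).homology n

/-- `Ext^n_{ℐ_C}(M, N) = H^n Hom_R(M, Y)` for a proper `ℐ_C`-injective resolution `Y` of `N`. -/
def extInj (C M N : ModuleCat.{u} R) (n : ℕ) : ModuleCat.{u} R :=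
  (homFrom M (Classical.arbitrary (ProperInjRes C N)).complex).homology n

/-- `sup {n | Ext^n_{𝒫_C}(M, -) ≠ 0}`. -/
def extProjSup (C M : ModuleCat.{u} R) : WithBot ℕ∞ :=
  ⨆ (n : ℕ) (_ : ∃ N : ModuleCat.{u} R, ¬ IsZero (extProj C M N n)), ((n : ℕ∞) : WithBot ℕ∞)

/-! ### Independence of the choice of resolution -/

lemma Lifts.of_iso {A B : ModuleCat.{u} R} {Z : ChainComplex (ModuleCat.{u} R) ℕ} (h : Lifts B Z)
    (e : A ≅ B) : Lifts A Z := by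
  refine ⟨fun f => ?_, fun n f hf => ?_⟩
  · obtain ⟨g, hg⟩ := h.1 (e.inv ≫ f)
    exact ⟨e.hom ≫ g, by rw [Category.assoc, hg, Iso.hom_inv_id_assoc]⟩
  · obtain ⟨g, hg⟩ := h.2 n (e.inv ≫ f) (by rw [Category.assoc, hf, comp_zero])
    exact ⟨e.hom ≫ g, by rw [Category.assoc, hg, Iso.hom_inv_id_assoc]⟩

lemma Extends.of_iso {A B : ModuleCat.{u} R} {Z : CochainComplex (ModuleCat.{u} R) ℕ}
    (h : Extends Z B) (e : A ≅ B) : Extends Z A := by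
  refine ⟨fun f => ?_, fun n f hf => ?_⟩
  · obtain ⟨g, hg⟩ := h.1 (f ≫ e.hom)
    exact ⟨g ≫ e.inv, by rw [← Category.assoc, hg, Category.assoc, Iso.hom_inv_id, Category.comp_id]⟩
  · obtain ⟨g, hg⟩ := h.2 n (f ≫ e.hom) (by rw [← Category.assoc, hf, zero_comp])
    exact ⟨g ≫ e.inv, by rw [← Category.assoc, hg, Category.assoc, Iso.hom_inv_id, Category.comp_id]⟩

lemma ProperProjRes.lifts {C M A : ModuleCat.{u} R} (X : ProperProjRes C M)
    (hA : IsCProjective C A) : Lifts A X.augmented := by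
  obtain ⟨Q, hQ, ⟨e⟩⟩ := hA
  exact ((homFrom_acyclic_iff _ _).1 (X.proper Q hQ)).of_iso e

namespace ProperProjRes

variable {C M : ModuleCat.{u} R} (X Y : ProperProjRes C M)

lemma exists_lift_ε (n : ℕ) (f : X.complex.X n ⟶ M) : ∃ g : X.complex.X n ⟶ Y.complex.X 0, g ≫ Y.ε = f :=
  (Y.lifts (X.cproj n)).1 f

lemma exists_lift_zero (n : ℕ) (f : X.complex.X n ⟶ Y.complex.X 0) (hf : f ≫ Y.ε = 0) :
    ∃ g : X.complex.X n ⟶ Y.complex.X 1, g ≫ Y.complex.d 1 0 = f :=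
  (Y.lifts (X.cproj n)).2 0 f hf

lemma exists_lift_succ (n m : ℕ) (f : X.complex.X n ⟶ Y.complex.X (m + 1))
    (hf : f ≫ Y.complex.d (m + 1) m = 0) :
    ∃ g : X.complex.X n ⟶ Y.complex.X (m + 2), g ≫ Y.complex.d (m + 2) (m + 1) = f :=
  (Y.lifts (X.cproj n)).2 (m + 1) f hf

lemma exists_hom : ∃ φ : X.complex ⟶ Y.complex, φ.f 0 ≫ Y.ε = X.ε := by
  choose a ha using X.exists_lift_ε Y 0
  choose b hb using X.exists_lift_zero Y
  choose c hc using X.exists_lift_succ Y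
  refine ⟨ChainComplex.mkHom _ _ (a X.ε)
    (b 1 (X.complex.d 1 0 ≫ a X.ε) (by rw [Category.assoc, ha, X.d_ε])) (hb _ _ _)
    (fun n p => ⟨c _ _ (X.complex.d (n + 2) (n + 1) ≫ p.2.1)
      (by rw [Category.assoc, p.2.2, HomologicalComplex.d_comp_d_assoc, zero_comp]), hc _ _ _ _⟩),
    ?_⟩
  rw [ChainComplex.mkHom_f_0, ha]

lemma nonempty_homotopy_zero (φ : X.complex ⟶ Y.complex) (h : φ.f 0 ≫ Y.ε = 0) :
    Nonempty (Homotopy φ 0) := by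
  choose b hb using X.exists_lift_zero Y
  choose c hc using X.exists_lift_succ Y
  have h1 : (φ.f 1 - X.complex.d 1 0 ≫ b 0 (φ.f 0) h) ≫ Y.complex.d 1 0 = 0 := by
    rw [Preadditive.sub_comp, Category.assoc, hb, HomologicalComplex.Hom.comm, sub_self]
  refine ⟨Homotopy.mkInductive φ (b 0 (φ.f 0) h) (hb _ _ _).symm
    (c 1 0 _ h1) (by rw [hc]; abel) (fun n p => ?_)⟩
  obtain ⟨p, p', hp⟩ := p
  have h2 : (φ.f (n + 2) - X.complex.d (n + 2) (n + 1) ≫ p') ≫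
      Y.complex.d (n + 2) (n + 1) = 0 := by
    rw [Preadditive.sub_comp, Category.assoc, HomologicalComplex.Hom.comm, hp,
      Preadditive.comp_add, HomologicalComplex.d_comp_d_assoc, zero_comp, zero_add, sub_self]
  exact ⟨c _ _ _ h2, by rw [hc]; abel⟩

lemma nonempty_homotopy (φ ψ : X.complex ⟶ Y.complex) (hφ : φ.f 0 ≫ Y.ε = X.ε)
    (hψ : ψ.f 0 ≫ Y.ε = X.ε) : Nonempty (Homotopy φ ψ) := by
  obtain ⟨h⟩ := X.nonempty_homotopy_zero Y (φ - ψ)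
    (by rw [HomologicalComplex.sub_f_apply, Preadditive.sub_comp, hφ, hψ, sub_self])
  exact ⟨Homotopy.equivSubZero.symm h⟩

lemma nonempty_homotopyEquiv : Nonempty (HomotopyEquiv X.complex Y.complex) := by
  obtain ⟨φ, hφ⟩ := X.exists_hom Y
  obtain ⟨ψ, hψ⟩ := Y.exists_hom X
  obtain ⟨h⟩ := X.nonempty_homotopy X (φ ≫ ψ) (𝟙 _)
    (by rw [HomologicalComplex.comp_f, Category.assoc, hψ, hφ]) (by simp)
  obtain ⟨k⟩ := Y.nonempty_homotopy Y (ψ ≫ φ) (𝟙 _)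
    (by rw [HomologicalComplex.comp_f, Category.assoc, hφ, hψ]) (by simp)
  exact ⟨⟨φ, ψ, h, k⟩⟩

/-- The relative cohomology can be computed by any proper resolution. -/
theorem nonempty_extProj_iso (N : ModuleCat.{u} R) (n : ℕ) :
    Nonempty (extProj C M N n ≅ (homInto X.complex N).homology n) := by
  obtain ⟨e⟩ := X.nonempty_homotopyEquiv (Classical.arbitrary (ProperProjRes C M))
  let F := ((linearYoneda R (ModuleCat.{u} R)).obj N).rightOp
  have i := (F.mapHomotopyEquiv e).toHomologyIso n
  exact ⟨HomologicalComplex.homologyUnop _ n ≪≫ i.unop ≪≫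
    (HomologicalComplex.homologyUnop _ n).symm⟩

end ProperProjRes

lemma ProperInjRes.exts {C N B : ModuleCat.{u} R} (Y : ProperInjRes C N)
    (hB : IsCInjective C B) : Extends (Y.complex.augment Y.η Y.η_d) B := by
  obtain ⟨J, hJ, ⟨e⟩⟩ := hB
  exact ((homInto_acyclic_iff _ _).1 (Y.proper J hJ)).of_iso e

namespace ProperInjRes

variable {C N : ModuleCat.{u} R} (X Y : ProperInjRes C N)

lemma exists_ext_η (n : ℕ) (f : N ⟶ Y.complex.X n) :
    ∃ g : X.complex.X 0 ⟶ Y.complex.X n, X.η ≫ g = f :=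
  (X.exts (Y.cinj n)).1 f

lemma exists_ext_zero (n : ℕ) (f : X.complex.X 0 ⟶ Y.complex.X n) (hf : X.η ≫ f = 0) :
    ∃ g : X.complex.X 1 ⟶ Y.complex.X n, X.complex.d 0 1 ≫ g = f :=
  (X.exts (Y.cinj n)).2 0 f hf

lemma exists_ext_succ (n m : ℕ) (f : X.complex.X (m + 1) ⟶ Y.complex.X n)
    (hf : X.complex.d m (m + 1) ≫ f = 0) :
    ∃ g : X.complex.X (m + 2) ⟶ Y.complex.X n, X.complex.d (m + 1) (m + 2) ≫ g = f :=
  (X.exts (Y.cinj n)).2 (m + 1) f hf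

lemma exists_hom : ∃ φ : X.complex ⟶ Y.complex, X.η ≫ φ.f 0 = Y.η := by
  choose a ha using X.exists_ext_η Y 0
  choose b hb using X.exists_ext_zero Y
  choose c hc using X.exists_ext_succ Y
  refine ⟨CochainComplex.mkHom _ _ (a Y.η)
    (b 1 (a Y.η ≫ Y.complex.d 0 1) (by rw [← Category.assoc, ha, Y.η_d])) (hb _ _ _).symm
    (fun n p => ⟨c _ _ (p.2.1 ≫ Y.complex.d (n + 1) (n + 2))
      (by rw [← Category.assoc, ← p.2.2, Category.assoc, HomologicalComplex.d_comp_d, comp_zero]),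
      (hc _ _ _ _).symm⟩),
    ?_⟩
  rw [CochainComplex.mkHom_f_0, ha]

lemma nonempty_homotopy_zero (φ : X.complex ⟶ Y.complex) (h : X.η ≫ φ.f 0 = 0) :
    Nonempty (Homotopy φ 0) := by
  choose b hb using X.exists_ext_zero Y
  choose c hc using X.exists_ext_succ Y
  have h1 : X.complex.d 0 1 ≫ (φ.f 1 - b 0 (φ.f 0) h ≫ Y.complex.d 0 1) = 0 := by
    rw [Preadditive.comp_sub, ← Category.assoc, hb, HomologicalComplex.Hom.comm, sub_self]
  refine ⟨Homotopy.mkCoinductive φ (b 0 (φ.f 0) h) (hb _ _ _).symm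
    (c 1 0 _ h1) (by rw [hc]; abel) (fun n p => ?_)⟩
  obtain ⟨p, p', hp⟩ := p
  have h2 : X.complex.d (n + 1) (n + 2) ≫
      (φ.f (n + 2) - p' ≫ Y.complex.d (n + 1) (n + 2)) = 0 := by
    rw [Preadditive.comp_sub, ← HomologicalComplex.Hom.comm, hp,
      Preadditive.add_comp, Category.assoc, HomologicalComplex.d_comp_d, comp_zero, zero_add,
      Category.assoc, sub_self]
  exact ⟨c _ _ _ h2, by rw [hc]; abel⟩

lemma nonempty_homotopy (φ ψ : X.complex ⟶ Y.complex) (hφ : X.η ≫ φ.f 0 = Y.η)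
    (hψ : X.η ≫ ψ.f 0 = Y.η) : Nonempty (Homotopy φ ψ) := by
  obtain ⟨h⟩ := X.nonempty_homotopy_zero Y (φ - ψ)
    (by rw [HomologicalComplex.sub_f_apply, Preadditive.comp_sub, hφ, hψ, sub_self])
  exact ⟨Homotopy.equivSubZero.symm h⟩

lemma nonempty_homotopyEquiv : Nonempty (HomotopyEquiv X.complex Y.complex) := by
  obtain ⟨φ, hφ⟩ := X.exists_hom Y
  obtain ⟨ψ, hψ⟩ := Y.exists_hom X
  obtain ⟨h⟩ := X.nonempty_homotopy X (φ ≫ ψ) (𝟙 _)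
    (by rw [HomologicalComplex.comp_f, ← Category.assoc, hφ, hψ]) (by simp)
  obtain ⟨k⟩ := Y.nonempty_homotopy Y (ψ ≫ φ) (𝟙 _)
    (by rw [HomologicalComplex.comp_f, ← Category.assoc, hψ, hφ]) (by simp)
  exact ⟨⟨φ, ψ, h, k⟩⟩

/-- The relative cohomology can be computed by any proper resolution. -/
theorem nonempty_extInj_iso (M : ModuleCat.{u} R) (n : ℕ) :
    Nonempty (extInj C M N n ≅ (homFrom M Y.complex).homology n) := by
  obtain ⟨e⟩ := (Classical.arbitrary (ProperInjRes C N)).nonempty_homotopyEquiv Y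
  exact ⟨(((linearCoyoneda R (ModuleCat.{u} R)).obj (op M)).mapHomotopyEquiv e).toHomologyIso n⟩

end ProperInjRes

end

end CRel

/-! For a bounded augmented complex with terms in `𝒫_C`, being proper is the same as being exact.
Since `Q` is projective, testing against all `C ⊗ Q` amounts to testing against `C` alone
(`Lifts.tensor_of_projective`). Two facts compare exactness of `Z` and of `Hom(C, Z)`. First,
`Ext^i(C, C ⊗ Q) = 0` for `i ≥ 1` (`extVanishes_tensor`), so descending induction from the zero end
of the complex gives Ext-vanishing for all kernels. Second, `Hom(C, K) = 0` forces `K = 0`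
(`IsSemidualizing.subsingleton_of_hom_eq_zero`), because `C` is finitely generated and faithful; no
Noetherian hypothesis is needed. Together these give `lifts_iff_acyclic`.

The injective statement reduces to the same lemma: exactness of a cochain complex `Z` is detected by
`Hom(Z, J)` with `J` injective, and `Hom(Z, Hom(C, J))` is `Hom(C, Hom(Z, J))`
(`extends_hom_iff_lifts`). The Ext-vanishing required is that of `Hom(Hom(C, I), J)`
(`extVanishes_hom_hom`).

For the Ext criteria, vanishing in degree `n + 1` is applied to one universal cocycle, the map of
`X_{n+1}` onto the image of its differential. It must extend to `X_n`, so this image is a direct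
summand and the resolution can be cut off at `X_n` modulo the image. The cut-off resolution stays in
`𝒫_C` because this class is closed under retracts (`isCProjective_of_retract`), and it stays proper
because the quotient maps in degrees `≤ n` split. The injective side is dual, with a kernel in place
of the image.

The equalities of dimensions follow by comparison with each natural number. The value `-∞` needs its
own argument, by `Ext^0`. -/

namespace CRel

open CategoryTheory CategoryTheory.Limits Opposite TensorProduct

noncomputable section

/-! ### Finitely generated faithful modules, and exactness of Hom. -/

section Algebra

variable {R : Type u} [CommRing R]

/-- If `x ≠ 0` is killed by the annihilator of a finitely generated submodule, then this
submodule has a nonzero map to the module containing `x`. -/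
theorem exists_ne_zero_of_finset {D M : Type*} [AddCommGroup D] [Module R D] [AddCommGroup M]
    [Module R M] (s : Finset D) (x : M) (hx : x ≠ 0)
    (h : ∀ r : R, (∀ d ∈ s, r • d = 0) → r • x = 0) :
    ∃ f : Submodule.span R (s : Set D) →ₗ[R] M, f ≠ 0 := by
  classical
  induction s using Finset.induction generalizing x with
  | empty => exact absurd (by simpa using h 1 (by simp)) hx
  | insert a s _ ih =>
    set N' := Submodule.span R (s : Set D) with hN'
    have hN : Submodule.span R ((insert a s : Finset D) : Set D) = R ∙ a ⊔ N' := by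
      rw [Finset.coe_insert, Submodule.span_insert]
    rw [hN]
    -- With `N = Ra + N'`, the quotient `N / N'` is `R / (N' : a)`. A nonzero `y` killed by the
    -- ideal `(N' : a)` therefore yields a nonzero map `N → N / N' → M` sending `a` to `y`.
    by_cases hy : ∃ y : M, y ≠ 0 ∧ ∀ r : R, r • a ∈ N' → r • y = 0
    · obtain ⟨y, hy0, hy⟩ := hy
      let p : (R ∙ a ⊔ N' : Submodule R D) →ₗ[R] (R ∙ (N'.mkQ a)) :=
        (N'.mkQ ∘ₗ Submodule.subtype _).codRestrict _ (by
          rintro ⟨c, hc⟩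
          have := Submodule.mem_map_of_mem (f := N'.mkQ) hc
          rwa [Submodule.map_sup, Submodule.map_span, Set.image_singleton,
            Submodule.mkQ_map_self, sup_bot_eq] at this)
      let q : (R ∙ (N'.mkQ a)) →ₗ[R] M :=
        (Submodule.liftQ (Ideal.torsionOf R _ (N'.mkQ a)) (LinearMap.toSpanSingleton R M y) (fun r hr => by
          have hr' : N'.mkQ (r • a) = 0 := by
            rw [map_smul]; exact (Ideal.mem_torsionOf_iff _ _).1 hr
          rw [LinearMap.mem_ker, LinearMap.toSpanSingleton_apply]
          exact hy r ((Submodule.Quotient.mk_eq_zero N').1 hr'))) ∘ₗ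
          (Ideal.quotTorsionOfEquivSpanSingleton R _ (N'.mkQ a)).symm.toLinearMap
      refine ⟨q ∘ₗ p, fun h0 => hy0 ?_⟩
      have ha : a ∈ (R ∙ a ⊔ N' : Submodule R D) :=
        Submodule.mem_sup_left (Submodule.mem_span_singleton_self a)
      have h1 : p ⟨a, ha⟩ = Ideal.quotTorsionOfEquivSpanSingleton R _ (N'.mkQ a)
          (Submodule.Quotient.mk 1) := Subtype.ext (by
        rw [Ideal.quotTorsionOfEquivSpanSingleton_apply_mk]
        exact (one_smul R _).symm)
      have h2 := LinearMap.congr_fun h0 ⟨a, ha⟩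
      rw [LinearMap.comp_apply, h1, LinearMap.comp_apply, LinearEquiv.coe_coe,
        LinearEquiv.symm_apply_apply] at h2
      exact (one_smul R y).symm.trans h2
    · push Not at hy
      -- Now no nonzero element of `M` is killed by `(N' : a)`. If `r` kills `s` but `r • x ≠ 0`,
      -- pick `t` in this ideal with `t • r • x ≠ 0`; then `t * r` kills both `a` and `s`,
      -- contradicting `h`.
      obtain ⟨f, hf⟩ := ih x hx (fun r hr => by
        by_contra hrx
        obtain ⟨t, ht, htx⟩ := hy _ hrx
        refine htx ?_
        rw [← mul_smul]
        refine h _ fun d hd => ?_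
        rcases Finset.mem_insert.1 hd with rfl | hd
        · rw [mul_comm, mul_smul]
          have : N' ≤ LinearMap.ker (LinearMap.lsmul R D r) :=
            Submodule.span_le.2 fun d hd => hr d hd
          exact this ht
        · rw [mul_smul, hr d hd, smul_zero])
      obtain ⟨n, hn⟩ : ∃ n, f n ≠ 0 := by
        by_contra! h0
        exact hf (LinearMap.ext h0)
      obtain ⟨t, ht, htn⟩ := hy _ hn
      -- Multiplication by `t` carries all of `N` into `N'`, so `f` precomposed with it is defined
      -- on `N`; at `n` its value is `t • f n ≠ 0`.
      let g : (R ∙ a ⊔ N' : Submodule R D) →ₗ[R] N' :=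
        ((LinearMap.lsmul R D t) ∘ₗ Submodule.subtype _).codRestrict _ (by
          rintro ⟨c, hc⟩
          have : R ∙ a ⊔ N' ≤ N'.comap (LinearMap.lsmul R D t) :=
            sup_le ((Submodule.span_singleton_le_iff_mem _ _).2 ht)
              fun c hc => N'.smul_mem t hc
          exact this hc)
      refine ⟨f ∘ₗ g, fun h0 => htn ?_⟩
      have h2 := LinearMap.congr_fun h0 ⟨n, Submodule.mem_sup_right n.2⟩
      rw [← map_smul]
      exact h2

/-- A finitely generated faithful module has a nonzero map to every nonzero module. -/
theorem subsingleton_of_hom_eq_zero {C M : Type*} [AddCommGroup C] [Module R C]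
    [AddCommGroup M] [Module R M] [Module.Finite R C]
    (hC : ∀ r : R, (∀ c : C, r • c = 0) → r = 0) (h : ∀ f : C →ₗ[R] M, f = 0) :
    Subsingleton M := by
  by_contra hM
  rw [not_subsingleton_iff_nontrivial] at hM
  obtain ⟨x, hx⟩ := exists_ne (0 : M)
  obtain ⟨s, hs⟩ := Module.Finite.fg_top (R := R) (M := C)
  obtain ⟨f, hf⟩ := exists_ne_zero_of_finset s x hx fun r hr => by
    rw [hC r fun c => ?_, zero_smul]
    have : Submodule.span R (s : Set C) ≤ LinearMap.ker (LinearMap.lsmul R C r) :=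
      Submodule.span_le.2 fun d hd => hr d hd
    exact this (hs ▸ Submodule.mem_top)
  refine hf (LinearMap.ext fun c => ?_)
  exact LinearMap.congr_fun (h (f ∘ₗ LinearMap.codRestrict _ LinearMap.id
    (fun c => hs ▸ Submodule.mem_top))) (c : C)

/-- Maps to an injective module extend along the second map of an exact pair as soon as they
vanish on the first one. -/
theorem exists_comp_eq_of_exact {A B D I : Type u} [AddCommGroup A] [Module R A]
    [AddCommGroup B] [Module R B] [AddCommGroup D] [Module R D] [AddCommGroup I] [Module R I]
    (hI : Module.Injective R I) {f : A →ₗ[R] B} {g : B →ₗ[R] D} (h : Function.Exact f g)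
    (φ : B →ₗ[R] I) (hφ : φ ∘ₗ f = 0) : ∃ ψ : D →ₗ[R] I, ψ ∘ₗ g = φ := by
  have hle : LinearMap.ker g ≤ LinearMap.ker φ := fun b hb => by
    obtain ⟨a, rfl⟩ := (h b).1 hb
    exact LinearMap.congr_fun hφ a
  -- The map `g` embeds `B / ker g` into `D`, and `φ` descends to this quotient.
  obtain ⟨ψ, hψ⟩ := hI.out ((LinearMap.ker g).liftQ g le_rfl)
    (LinearMap.ker_eq_bot.1 (Submodule.ker_liftQ_eq_bot _ _ _ le_rfl))
    ((LinearMap.ker g).liftQ φ hle)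
  exact ⟨ψ, LinearMap.ext fun b => by simpa using hψ (Submodule.Quotient.mk b)⟩

/-- The functor `Hom(-, I)` is exact for injective `I`. -/
theorem exact_lcomp_of_exact {A B D I : Type u} [AddCommGroup A] [Module R A]
    [AddCommGroup B] [Module R B] [AddCommGroup D] [Module R D] [AddCommGroup I] [Module R I]
    (hI : Module.Injective R I) {f : A →ₗ[R] B} {g : B →ₗ[R] D} (h : Function.Exact f g) :
    Function.Exact (g.lcomp R I) (f.lcomp R I) := by
  intro φ
  refine ⟨fun hφ => exists_comp_eq_of_exact hI h φ hφ, ?_⟩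
  rintro ⟨ψ, rfl⟩
  ext a
  simp [h.apply_apply_eq_zero]

/-- `Hom(-, D)` turns right exact sequences into left exact ones. -/
theorem exact_lcomp_of_surjective {A B E D : Type*} [AddCommGroup A] [Module R A]
    [AddCommGroup B] [Module R B] [AddCommGroup E] [Module R E] [AddCommGroup D] [Module R D]
    {f : A →ₗ[R] B} {g : B →ₗ[R] E} (h : Function.Exact f g) (hg : Function.Surjective g) :
    Function.Exact (g.lcomp R D) (f.lcomp R D) := by
  intro φ
  refine ⟨fun hφ => ?_, ?_⟩
  · have hle : LinearMap.ker g ≤ LinearMap.ker φ := fun b hb => by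
      obtain ⟨a, rfl⟩ := (h b).1 hb
      exact LinearMap.congr_fun hφ a
    refine ⟨(LinearMap.ker g).liftQ φ hle ∘ₗ (g.quotKerEquivOfSurjective hg).symm.toLinearMap,
      LinearMap.ext fun b => ?_⟩
    have : (g.quotKerEquivOfSurjective hg).symm (g b) = Submodule.Quotient.mk b := by
      rw [LinearEquiv.symm_apply_eq]; rfl
    simp [this]
  · rintro ⟨ψ, rfl⟩
    ext a
    simp [h.apply_apply_eq_zero]

/-! ### Tensor evaluation and Hom evaluation for finitely presented modules. -/

section HomTensor

variable {F₁ F₀ C D Q : Type u} [AddCommGroup F₁] [Module R F₁] [AddCommGroup F₀] [Module R F₀]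
  [AddCommGroup C] [Module R C] [AddCommGroup D] [Module R D] [AddCommGroup Q] [Module R Q]

/-- The natural map `Hom(F, D) ⊗ Q → Hom(F, D ⊗ Q)`. -/
abbrev homTensor (F D Q : Type*) [AddCommGroup F] [Module R F] [AddCommGroup D] [Module R D]
    [AddCommGroup Q] [Module R Q] : (F →ₗ[R] D) ⊗[R] Q →ₗ[R] F →ₗ[R] D ⊗[R] Q :=
  TensorProduct.rTensorHomToHomRTensor (.id R) F D Q

theorem homTensor_bijective (F D Q : Type*) [AddCommGroup F] [Module R F] [AddCommGroup D]
    [Module R D] [AddCommGroup Q] [Module R Q] [Module.Finite R F] [Module.Projective R F] :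
    Function.Bijective (homTensor (R := R) F D Q) := by
  rw [homTensor, ← rTensorHomEquivHomRTensor_toLinearMap]
  exact (rTensorHomEquivHomRTensor R F D Q).bijective

theorem homTensor_lcomp (f : F₁ →ₗ[R] F₀) (t : (F₀ →ₗ[R] D) ⊗[R] Q) :
    homTensor F₁ D Q ((f.lcomp R D).rTensor Q t) = homTensor F₀ D Q t ∘ₗ f := by
  induction t with
  | zero => simp
  | add x y hx hy => rw [map_add, map_add, hx, hy, map_add, LinearMap.add_comp]
  | tmul φ q => ext; simp

/-- For finitely presented `C` and flat `Q`, the map `Hom(C, D) ⊗ Q → Hom(C, D ⊗ Q)` is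
bijective. -/
theorem homTensor_bijective_of_presentation [Module.Finite R F₁] [Module.Projective R F₁]
    [Module.Finite R F₀] [Module.Projective R F₀] [Module.Flat R Q]
    {f : F₁ →ₗ[R] F₀} {g : F₀ →ₗ[R] C} (h : Function.Exact f g) (hg : Function.Surjective g) :
    Function.Bijective (homTensor (R := R) C D Q) := by
  have hinj : Function.Injective ((g.lcomp R D).rTensor Q) :=
    Module.Flat.rTensor_preserves_injective_linearMap _ fun a b hab => by
      exact (LinearMap.cancel_right hg).1 hab
  -- Both sides are left exact in the first argument (flatness of `Q` is used on the left), so the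
  -- isomorphisms for `F₀` and `F₁` pass to the kernels.
  have hex := Module.Flat.rTensor_exact Q (exact_lcomp_of_surjective (D := D) h hg)
  constructor
  · refine (injective_iff_map_eq_zero _).2 fun t ht => hinj ((homTensor_bijective F₀ D Q).1 ?_)
    rw [homTensor_lcomp, ht, LinearMap.zero_comp, map_zero, map_zero]
  · intro φ
    obtain ⟨t, ht⟩ := (homTensor_bijective F₀ D Q).2 (φ ∘ₗ g)
    obtain ⟨s, rfl⟩ := (hex t).1 ((homTensor_bijective F₁ D Q).1 (by
      rw [homTensor_lcomp, ht, map_zero, LinearMap.comp_assoc, h.linearMap_comp_eq_zero,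
        LinearMap.comp_zero]))
    rw [homTensor_lcomp] at ht
    exact ⟨s, (LinearMap.cancel_right hg).1 ht⟩

/-- The natural map `F ⊗ Hom(D, I) → Hom(Hom(F, D), I)`. -/
def tensorHom (F D I : Type*) [AddCommGroup F] [Module R F] [AddCommGroup D] [Module R D]
    [AddCommGroup I] [Module R I] : F ⊗[R] (D →ₗ[R] I) →ₗ[R] (F →ₗ[R] D) →ₗ[R] I :=
  TensorProduct.lift (LinearMap.mk₂ R (fun x φ => φ ∘ₗ LinearMap.applyₗ x)
    (by intros; ext; simp) (by intros; ext; simp) (by intros; ext; simp) (by intros; ext; simp))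

@[simp]
theorem tensorHom_tmul {F D I : Type*} [AddCommGroup F] [Module R F] [AddCommGroup D]
    [Module R D] [AddCommGroup I] [Module R I] (x : F) (φ : D →ₗ[R] I) (ψ : F →ₗ[R] D) :
    tensorHom F D I (x ⊗ₜ φ) ψ = φ (ψ x) := rfl

theorem tensorHom_rTensor {F₁ F₀ D I : Type*} [AddCommGroup F₁] [Module R F₁]
    [AddCommGroup F₀] [Module R F₀] [AddCommGroup D] [Module R D] [AddCommGroup I] [Module R I]
    (f : F₁ →ₗ[R] F₀) (t : F₁ ⊗[R] (D →ₗ[R] I)) :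
    tensorHom F₀ D I (f.rTensor _ t) = tensorHom F₁ D I t ∘ₗ f.lcomp R D := by
  induction t with
  | zero => simp
  | add x y hx hy => rw [map_add, map_add, hx, hy, map_add, LinearMap.add_comp]
  | tmul φ q => ext; simp

theorem tensorHom_bijective (F D I : Type*) [AddCommGroup F] [Module R F] [AddCommGroup D]
    [Module R D] [AddCommGroup I] [Module R I] [Module.Finite R F] [Module.Projective R F] :
    Function.Bijective (tensorHom (R := R) F D I) := by
  -- Splitting `F` off `Rⁿ` provides a finite dual basis `e i`, `ξ i`.
  obtain ⟨n, p, s, -, -, hps⟩ := Module.Finite.exists_comp_eq_id_of_projective R F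
  let e : Fin n → F := fun i => p (Pi.single i 1)
  let ξ : Fin n → F →ₗ[R] R := fun i => LinearMap.proj i ∘ₗ s
  have he : ∀ x, ∑ i, ξ i x • e i = x := fun x => by
    have h1 : p (s x) = x := LinearMap.congr_fun hps x
    conv_rhs => rw [← h1, pi_eq_sum_univ' (s x), map_sum]
    refine Finset.sum_congr rfl fun i _ => ?_
    rw [map_smul]
    rfl
  -- The inverse sends `Φ` to `∑ e i ⊗ (d ↦ Φ (ξ i · d))`.
  let inv : ((F →ₗ[R] D) →ₗ[R] I) →ₗ[R] F ⊗[R] (D →ₗ[R] I) :=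
    ∑ i, (TensorProduct.mk R F (D →ₗ[R] I) (e i)) ∘ₗ
      ((LinearMap.smulRightₗ (ξ i)).lcomp R I)
  refine Function.bijective_iff_has_inverse.2 ⟨inv, fun t => ?_, fun Φ => LinearMap.ext fun ψ => ?_⟩
  · induction t with
    | zero => simp
    | add x y hx hy => rw [map_add, map_add, hx, hy]
    | tmul x φ =>
      have : ∀ i, (LinearMap.smulRightₗ (ξ i)).lcomp R I (tensorHom F D I (x ⊗ₜ φ)) =
          ξ i x • φ := fun i => by ext; simp
      simp only [inv, LinearMap.sum_apply, LinearMap.comp_apply, this, TensorProduct.mk_apply,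
        ← TensorProduct.smul_tmul]
      rw [← TensorProduct.sum_tmul, he]
  · simp only [inv, LinearMap.sum_apply, LinearMap.comp_apply, map_sum, TensorProduct.mk_apply,
      tensorHom_tmul, LinearMap.lcomp_apply]
    rw [← map_sum]
    congr 1
    ext x
    rw [LinearMap.sum_apply]
    conv_rhs => rw [← he x, map_sum]
    simp

/-- For finitely presented `C` and injective `I`, the map `C ⊗ Hom(D, I) → Hom(Hom(C, D), I)` is
bijective. -/
theorem tensorHom_bijective_of_presentation {I : Type u} [AddCommGroup I] [Module R I]
    (hI : Module.Injective R I) [Module.Finite R F₁] [Module.Projective R F₁]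
    [Module.Finite R F₀] [Module.Projective R F₀]
    {f : F₁ →ₗ[R] F₀} {g : F₀ →ₗ[R] C} (h : Function.Exact f g) (hg : Function.Surjective g) :
    Function.Bijective (tensorHom (R := R) C D I) := by
  -- Both sides are right exact in the first argument: `Hom(-, D)` is left exact and injectivity of
  -- `I` makes `Hom(-, I)` exact. The isomorphisms for `F₀` and `F₁` thus pass to cokernels.
  have hex := exact_lcomp_of_surjective (D := D) h hg
  have hsurj : Function.Surjective (g.rTensor (D →ₗ[R] I)) := LinearMap.rTensor_surjective _ hg
  constructor
  · refine (injective_iff_map_eq_zero _).2 fun t ht => ?_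
    obtain ⟨y, rfl⟩ := hsurj t
    rw [tensorHom_rTensor] at ht
    obtain ⟨ψ, hψ⟩ := exists_comp_eq_of_exact hI hex _ ht
    obtain ⟨z, rfl⟩ := (tensorHom_bijective F₁ D I).2 ψ
    rw [← tensorHom_rTensor] at hψ
    rw [← (tensorHom_bijective F₀ D I).1 hψ, ← LinearMap.comp_apply, ← LinearMap.rTensor_comp,
      h.linearMap_comp_eq_zero, LinearMap.rTensor_zero, LinearMap.zero_apply]
  · intro φ
    obtain ⟨ψ, hψ⟩ := hI.out (g.lcomp R D) (fun a b hab => (LinearMap.cancel_right hg).1 hab) φ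
    obtain ⟨z, rfl⟩ := (tensorHom_bijective F₀ D I).2 ψ
    refine ⟨g.rTensor _ z, ?_⟩
    rw [tensorHom_rTensor]
    exact LinearMap.ext hψ

end HomTensor

end Algebra

/-! ### Vanishing of `Ext(C, -)`, and exactness before and after `Hom(C, -)`. -/

section ExtVanishing

variable {R : Type u} [CommRing R]

/-- `Ext^i(C, K) = 0` for all `i ≥ 1`. -/
def ExtVanishes (C K : ModuleCat.{u} R) : Prop :=
  ∀ i : ℕ, 1 ≤ i → Subsingleton (Abelian.Ext C K i)

/-- A class in `Ext^{n+1}` is represented by a cocycle on `P_{n+1}`, and is zero exactly when that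
cocycle is a coboundary. -/
theorem extVanishes_iff {C : ModuleCat.{u} R} (P : ProjectiveResolution C) (K : ModuleCat.{u} R) :
    ExtVanishes C K ↔ ∀ (n : ℕ) (f : P.complex.X (n + 1) ⟶ K), P.complex.d (n + 2) (n + 1) ≫ f = 0 →
      ∃ g : P.complex.X n ⟶ K, P.complex.d (n + 1) n ≫ g = f := by
  constructor
  · intro h n f hf
    have := h (n + 1) (by lia)
    exact (P.extMk_eq_zero_iff f (n + 2) rfl hf n rfl).1 (Subsingleton.elim _ _)
  · rintro h (_ | n) hi
    · lia
    · refine subsingleton_of_forall_eq 0 fun α => ?_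
      obtain ⟨f, hf, rfl⟩ := P.extMk_surjective α (n + 2) rfl
      exact (P.extMk_eq_zero_iff f (n + 2) rfl hf n rfl).2 (h n f hf)

theorem extVanishes_iff_exact {C : ModuleCat.{u} R} (P : ProjectiveResolution C)
    (K : ModuleCat.{u} R) :
    ExtVanishes C K ↔ ∀ n : ℕ, Function.Exact
      ((P.complex.d (n + 1) n).hom.lcomp R K) ((P.complex.d (n + 2) (n + 1)).hom.lcomp R K) := by
  rw [extVanishes_iff P]
  refine forall_congr' fun n => ⟨fun h φ => ⟨fun hφ => ?_, ?_⟩, fun h f hf => ?_⟩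
  · obtain ⟨g, hg⟩ := h (ModuleCat.ofHom φ) (ModuleCat.hom_ext hφ)
    exact ⟨g.hom, congrArg ModuleCat.Hom.hom hg⟩
  · rintro ⟨g, rfl⟩
    have := P.complex.d_comp_d (n + 2) (n + 1) n
    rw [LinearMap.lcomp_apply', LinearMap.lcomp_apply', LinearMap.comp_assoc,
      ← ModuleCat.hom_comp, this, ModuleCat.hom_zero, LinearMap.comp_zero]
  · obtain ⟨g, hg⟩ := (h f.hom).1 (congrArg ModuleCat.Hom.hom hf)
    exact ⟨ModuleCat.ofHom g, ModuleCat.hom_ext hg⟩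

theorem ExtVanishes.of_iso {C K L : ModuleCat.{u} R} (h : ExtVanishes C K) (e : K ≅ L) :
    ExtVanishes C L := by
  intro i hi
  have := h i hi
  refine subsingleton_of_forall_eq 0 fun α => ?_
  have h1 : α.comp (Abelian.Ext.mk₀ e.inv) (add_zero i) = 0 := Subsingleton.elim _ _
  have h2 := congrArg (fun β => β.comp (Abelian.Ext.mk₀ e.hom) (add_zero i)) h1
  simpa using h2

theorem ExtVanishes.of_subsingleton (C K : ModuleCat.{u} R) [Subsingleton K] :
    ExtVanishes C K := by
  intro i _
  refine subsingleton_of_forall_eq 0 fun α => ?_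
  have h : 𝟙 K = 0 := (ModuleCat.isZero_of_subsingleton K).eq_of_src _ _
  have h2 := α.comp_mk₀_id
  rwa [h, Abelian.Ext.mk₀_zero, Abelian.Ext.comp_zero, eq_comm] at h2

/-- The short exact sequence `0 → ker p → L → N → 0`. -/
theorem shortExact_ker {L N : ModuleCat.{u} R} (p : L ⟶ N) (hp : Function.Surjective p.hom) :
    (ShortComplex.mk (ModuleCat.ofHom (LinearMap.ker p.hom).subtype) p
      (by ext x; exact x.2)).ShortExact := by
  refine { exact := ?_, mono_f := ?_, epi_g := ?_ }
  · rw [ShortComplex.moduleCat_exact_iff]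
    exact fun x hx => ⟨⟨x, hx⟩, rfl⟩
  · exact (ModuleCat.mono_iff_injective _).2 (Submodule.subtype_injective _)
  · exact (ModuleCat.epi_iff_surjective _).2 hp

/-- The obstruction to lifting is the connecting image of `f` in `Ext^1(C, ker p)`. -/
theorem ExtVanishes.exists_lift {C L N : ModuleCat.{u} R} (p : L ⟶ N)
    (hp : Function.Surjective p.hom)
    (h : ExtVanishes C (ModuleCat.of R (LinearMap.ker p.hom))) (f : C ⟶ N) :
    ∃ g : C ⟶ L, g ≫ p = f := by
  have := h 1 le_rfl
  obtain ⟨x, hx⟩ := Abelian.Ext.covariant_sequence_exact₃ C (shortExact_ker p hp)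
    (Abelian.Ext.mk₀ f) (zero_add 1) (Subsingleton.elim _ _)
  obtain ⟨g, rfl⟩ := (Abelian.Ext.mk₀_bijective C L).2 x
  refine ⟨g, (Abelian.Ext.mk₀_bijective C N).1 ?_⟩
  rwa [Abelian.Ext.mk₀_comp_mk₀] at hx

/-- In the long exact sequence, `Ext^i(C, N)` lies between `Ext^i(C, L)` and `Ext^{i+1}(C, ker p)`.
-/
theorem ExtVanishes.of_surjective {C L N : ModuleCat.{u} R} (p : L ⟶ N)
    (hp : Function.Surjective p.hom)
    (h : ExtVanishes C (ModuleCat.of R (LinearMap.ker p.hom))) (hL : ExtVanishes C L) :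
    ExtVanishes C N := by
  intro i hi
  have := h (i + 1) (by lia)
  have := hL i hi
  refine subsingleton_of_forall_eq 0 fun α => ?_
  obtain ⟨x, rfl⟩ := Abelian.Ext.covariant_sequence_exact₃ C (shortExact_ker p hp)
    α rfl (Subsingleton.elim _ _)
  rw [Subsingleton.elim x 0, Abelian.Ext.zero_comp]

/-- If the kernel of `f : A → B` has vanishing `Ext(C, -)`, then every map from `C` to the range
of `f` lifts to `A`. -/
theorem ExtVanishes.exists_lift_of_range {C A B : ModuleCat.{u} R} (f : A ⟶ B)
    (h : ExtVanishes C (ModuleCat.of R (LinearMap.ker f.hom))) (φ : C ⟶ B)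
    (hφ : ∀ x, φ.hom x ∈ LinearMap.range f.hom) : ∃ g : C ⟶ A, g ≫ f = φ := by
  obtain ⟨g, hg⟩ := ExtVanishes.exists_lift (C := C)
    (ModuleCat.ofHom f.hom.rangeRestrict) f.hom.surjective_rangeRestrict
    (by rwa [ModuleCat.hom_ofHom, LinearMap.ker_rangeRestrict])
    (ModuleCat.ofHom (φ.hom.codRestrict _ hφ))
  exact ⟨g, congrArg (· ≫ ModuleCat.ofHom (Submodule.subtype _)) hg⟩

theorem ExtVanishes.range {C A B : ModuleCat.{u} R} (f : A ⟶ B)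
    (h : ExtVanishes C (ModuleCat.of R (LinearMap.ker f.hom))) (hA : ExtVanishes C A) :
    ExtVanishes C (ModuleCat.of R (LinearMap.range f.hom)) :=
  ExtVanishes.of_surjective (ModuleCat.ofHom f.hom.rangeRestrict) f.hom.surjective_rangeRestrict
    (by rwa [ModuleCat.hom_ofHom, LinearMap.ker_rangeRestrict]) hA

/-- If `Hom(C, -)` detects nonzero modules, then, under vanishing of `Ext(C, -)`, exactness after
applying `Hom(C, -)` implies exactness. -/
theorem ExtVanishes.range_eq_ker {C A B D : ModuleCat.{u} R}
    (hC : ∀ K : ModuleCat.{u} R, (∀ f : C ⟶ K, f = 0) → Subsingleton K)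
    (f : A ⟶ B) (g : B ⟶ D) (w : f ≫ g = 0)
    (h : ExtVanishes C (ModuleCat.of R (LinearMap.ker f.hom))) (hA : ExtVanishes C A)
    (hl : ∀ φ : C ⟶ B, φ ≫ g = 0 → ∃ ψ : C ⟶ A, ψ ≫ f = φ) :
    LinearMap.range f.hom = LinearMap.ker g.hom := by
  have hle : LinearMap.range f.hom ≤ LinearMap.ker g.hom := by
    rintro _ ⟨a, rfl⟩
    exact congrArg (fun k => k.hom a) w
  refine le_antisymm hle ?_
  -- The homology at `B` is `ker g / N`. A map from `C` to it lifts to `ker g`, as `Ext^1(C, N) =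
  -- 0`, and then to `A` by `hl`; hence it is zero, and `hC` kills the homology.
  let N : Submodule R (LinearMap.ker g.hom) :=
    (LinearMap.range f.hom).comap (LinearMap.ker g.hom).subtype
  have hN : ExtVanishes C (ModuleCat.of R N) :=
    (h.range f hA).of_iso (Submodule.comapSubtypeEquivOfLe hle).symm.toModuleIso
  have hsub : Subsingleton (LinearMap.ker g.hom ⧸ N) := by
    refine hC (ModuleCat.of R (LinearMap.ker g.hom ⧸ N)) fun φ => ?_
    obtain ⟨ψ, rfl⟩ := ExtVanishes.exists_lift (C := C)
      (L := ModuleCat.of R (LinearMap.ker g.hom)) (ModuleCat.ofHom N.mkQ) N.mkQ_surjective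
      (by rwa [ModuleCat.hom_ofHom, Submodule.ker_mkQ]) φ
    obtain ⟨θ, hθ⟩ := hl (ψ ≫ ModuleCat.ofHom (Submodule.subtype _)) (by
      ext x
      exact (ψ.hom x).2)
    ext x
    refine (Submodule.Quotient.mk_eq_zero N).2 ?_
    exact ⟨θ.hom x, congrArg (fun k => k.hom x) hθ⟩
  intro b hb
  have : N = ⊤ := Submodule.Quotient.subsingleton_iff.1 hsub
  exact (this ▸ Submodule.mem_top : (⟨b, hb⟩ : LinearMap.ker g.hom) ∈ N)

theorem acyclic_iff_range_eq_ker (Z : ChainComplex (ModuleCat.{u} R) ℕ) :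
    Z.Acyclic ↔ LinearMap.range (Z.d 1 0).hom = ⊤ ∧
      ∀ n, LinearMap.range (Z.d (n + 2) (n + 1)).hom = LinearMap.ker (Z.d (n + 1) n).hom := by
  have key : ∀ i j k, (ComplexShape.down ℕ).prev j = i → (ComplexShape.down ℕ).next j = k →
      (Z.ExactAt j ↔ LinearMap.range (Z.d i j).hom = LinearMap.ker (Z.d j k).hom) := by
    intro i j k hi hk
    rw [HomologicalComplex.exactAt_iff' _ i j k hi hk,
      ShortComplex.moduleCat_exact_iff_range_eq_ker]
    rfl
  -- In degree `0` the successor index is `0` itself, so the outgoing differential is the zero map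
  -- `d 0 0`.
  have h0 : LinearMap.ker (Z.d 0 0).hom = ⊤ := by
    rw [Z.shape 0 0 (by simp), ModuleCat.hom_zero, LinearMap.ker_zero]
  constructor
  · exact fun h => ⟨h0 ▸ (key 1 0 0 (by simp) (by simp)).1 (h 0),
      fun n => (key (n + 2) (n + 1) n (by simp) (by simp)).1 (h (n + 1))⟩
  · rintro ⟨h, h'⟩ (_ | n)
    · exact (key 1 0 0 (by simp) (by simp)).2 (h0.symm ▸ h)
    · exact (key (n + 2) (n + 1) n (by simp) (by simp)).2 (h' n)

/-- A bounded complex, whose terms in positive degrees have vanishing `Ext(C, -)`, is acyclic if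
and only if it is so after applying `Hom(C, -)`. -/
theorem lifts_iff_acyclic {C : ModuleCat.{u} R}
    (hC : ∀ K : ModuleCat.{u} R, (∀ f : C ⟶ K, f = 0) → Subsingleton K)
    (Z : ChainComplex (ModuleCat.{u} R) ℕ) (hZ : ∀ n, ExtVanishes C (Z.X (n + 1)))
    (N : ℕ) (hN : ∀ n, N ≤ n → IsZero (Z.X (n + 1))) : Lifts C Z ↔ Z.Acyclic := by
  have top : ∀ n, N ≤ n → ExtVanishes C (ModuleCat.of R (LinearMap.ker (Z.d (n + 1) n).hom)) :=
    fun n hn => by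
      have := ModuleCat.subsingleton_of_isZero (hN n hn)
      exact ExtVanishes.of_subsingleton _ _
  -- Descending induction from `N`, where the kernels are zero. Each direction of the equivalence
  -- supplies the inductive step, since it identifies a kernel with the preceding range.
  have down : (∀ n, ExtVanishes C (ModuleCat.of R (LinearMap.ker (Z.d (n + 2) (n + 1)).hom)) →
      ExtVanishes C (ModuleCat.of R (LinearMap.ker (Z.d (n + 1) n).hom))) →
      ∀ n, ExtVanishes C (ModuleCat.of R (LinearMap.ker (Z.d (n + 1) n).hom)) := fun h n => by
    by_cases hn : N ≤ n
    · exact top n hn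
    · exact Nat.decreasingInduction (motive := fun n _ =>
        ExtVanishes C (ModuleCat.of R (LinearMap.ker (Z.d (n + 1) n).hom)))
        (fun k _ hk => h k hk) (top N le_rfl) (le_of_not_ge hn)
  rw [acyclic_iff_range_eq_ker]
  constructor
  · rintro ⟨h0, h1⟩
    have ex : ∀ n, ExtVanishes C (ModuleCat.of R (LinearMap.ker (Z.d (n + 2) (n + 1)).hom)) →
        LinearMap.range (Z.d (n + 2) (n + 1)).hom = LinearMap.ker (Z.d (n + 1) n).hom :=
      fun n h => h.range_eq_ker hC _ _ (Z.d_comp_d _ _ _) (hZ _) (h1 n)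
    have van := down fun n h => ex n h ▸ h.range _ (hZ _)
    refine ⟨?_, fun n => ex n (van _)⟩
    -- Surjectivity of `d 1 0` is exactness at `Z.X 0` followed by the zero map; no Ext-vanishing of
    -- `Z.X 0` is involved.
    have := (van 0).range_eq_ker hC _ (0 : Z.X 0 ⟶ Z.X 0) comp_zero (hZ _) fun φ _ => h0 φ
    rwa [ModuleCat.hom_zero, LinearMap.ker_zero] at this
  · rintro ⟨h0, h1⟩
    have van := down fun n h => h1 n ▸ h.range _ (hZ _)
    refine ⟨fun f => (van 0).exists_lift_of_range _ f fun x => h0 ▸ Submodule.mem_top,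
      fun n f hf => (van (n + 1)).exists_lift_of_range _ f fun x => ?_⟩
    rw [h1]
    exact congrArg (fun k => k.hom x) hf

end ExtVanishing

/-! ### Homological properties of `𝒫_C` and `ℐ_C`. -/

section Semidualizing

variable {R : Type u} [CommRing R] {C : ModuleCat.{u} R}

/-- The augmentation of a projective resolution, with target the resolved module. -/
def resolutionAugmentation (P : ProjectiveResolution C) : P.complex.X 0 ⟶ C :=
  P.π.f 0 ≫ (HomologicalComplex.singleObjXSelf (ComplexShape.down ℕ) 0 C).hom

theorem resolutionAugmentation_surjective (P : ProjectiveResolution C) :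
    Function.Surjective (resolutionAugmentation P).hom := by
  rw [← ModuleCat.epi_iff_surjective]
  unfold resolutionAugmentation
  infer_instance

theorem exact_resolutionAugmentation (P : ProjectiveResolution C) :
    Function.Exact (P.complex.d 1 0).hom (resolutionAugmentation P).hom := by
  have h := P.exact₀
  rw [ShortComplex.moduleCat_exact_iff] at h
  have h0 := P.complex_d_comp_π_f_zero
  intro x
  constructor
  · intro hx
    refine h x ((ModuleCat.mono_iff_injective
      (HomologicalComplex.singleObjXSelf (ComplexShape.down ℕ) 0 C).hom).1 inferInstance ?_)
    rw [map_zero]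
    exact hx
  · rintro ⟨y, rfl⟩
    have : P.complex.d 1 0 ≫ resolutionAugmentation P = 0 := by
      rw [resolutionAugmentation, reassoc_of% h0, zero_comp]
    exact congrArg (fun k => k.hom y) this

/-- `C` is finitely generated as a quotient of `P_0`, and faithful because the homothety map is
injective. -/
theorem IsSemidualizing.subsingleton_of_hom_eq_zero (hC : IsSemidualizing C)
    (K : ModuleCat.{u} R) (h : ∀ f : C ⟶ K, f = 0) : Subsingleton K := by
  obtain ⟨P, hP⟩ := hC.finite_resolution
  have := hP 0
  have : Module.Finite R C := Module.Finite.of_surjective _ (resolutionAugmentation_surjective P)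
  refine CRel.subsingleton_of_hom_eq_zero (R := R) (C := C) (M := K) (fun r hr => ?_) fun f =>
    congrArg ModuleCat.Hom.hom (h (ModuleCat.ofHom f))
  refine hC.homothety.1 ?_
  rw [map_zero]
  exact LinearMap.ext hr

/-- For a resolution `P` of `C` by finite projectives, `Hom(P, C ⊗ Q)` is `Hom(P, C) ⊗ Q`, and
tensoring with the flat module `Q` preserves the exactness given by `Ext^i(C, C) = 0`. -/
theorem extVanishes_tensor (hC : IsSemidualizing C) (Q : ModuleCat.{u} R)
    [Module.Flat R Q] : ExtVanishes C (tensor C Q) := by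
  obtain ⟨P, hP⟩ := hC.finite_resolution
  have hproj : ∀ n, Module.Projective R (P.complex.X n) := fun n =>
    (IsProjective.iff_projective _).2 (P.projective n)
  have hCC := (extVanishes_iff_exact P C).1 hC.ext_self
  refine (extVanishes_iff_exact P _).2 fun n => ?_
  have hex := Module.Flat.rTensor_exact Q (hCC n)
  intro φ
  constructor
  · intro hφ
    obtain ⟨t, rfl⟩ := (homTensor_bijective _ C Q).2 φ
    obtain ⟨s, rfl⟩ := (hex t).1 ((homTensor_bijective _ C Q).1 (by
      rw [homTensor_lcomp, map_zero]; exact hφ))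
    exact ⟨homTensor _ C Q s, (homTensor_lcomp _ _).symm⟩
  · rintro ⟨ψ, rfl⟩
    obtain ⟨s, rfl⟩ := (homTensor_bijective _ C Q).2 ψ
    rw [LinearMap.lcomp_apply', LinearMap.lcomp_apply', ← homTensor_lcomp, ← homTensor_lcomp,
      hex.apply_apply_eq_zero, map_zero]

theorem extVanishes_of_isCProjective (hC : IsSemidualizing C) {X : ModuleCat.{u} R}
    (hX : IsCProjective C X) : ExtVanishes C X := by
  obtain ⟨Q, hQ, ⟨e⟩⟩ := hX
  exact (extVanishes_tensor hC Q).of_iso e.symm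

/-- The complex `F ⊗ Hom(C, I)` is exact in positive degrees. -/
theorem exact_rTensor_hom (hC : IsSemidualizing C) (P : ProjectiveResolution C)
    (hP : ∀ n, Module.Finite R (P.complex.X n)) {I : ModuleCat.{u} R}
    (hI : Module.Injective R I) (n : ℕ) :
    Function.Exact ((P.complex.d (n + 2) (n + 1)).hom.rTensor (C →ₗ[R] I))
      ((P.complex.d (n + 1) n).hom.rTensor (C →ₗ[R] I)) := by
  have hproj : ∀ n, Module.Projective R (P.complex.X n) := fun n =>
    (IsProjective.iff_projective _).2 (P.projective n)
  -- The complex `P ⊗ Hom(C, I)` is identified with `Hom(Hom(P, C), I)`, and `Hom(P, C)` is exact in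
  -- positive degrees.
  have hex := exact_lcomp_of_exact hI ((extVanishes_iff_exact P C).1 hC.ext_self n)
  intro t
  constructor
  · intro ht
    obtain ⟨s, hs⟩ := (hex (tensorHom _ C I t)).1 (by
      rw [LinearMap.lcomp_apply', ← tensorHom_rTensor, ht, map_zero])
    obtain ⟨s, rfl⟩ := (tensorHom_bijective _ C I).2 s
    refine ⟨s, (tensorHom_bijective _ C I).1 ?_⟩
    rw [tensorHom_rTensor]
    exact hs
  · rintro ⟨s, rfl⟩
    refine (tensorHom_bijective _ C I).1 ?_
    rw [tensorHom_rTensor, tensorHom_rTensor, map_zero]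
    exact hex.apply_apply_eq_zero _

/-- By adjunction, `Hom(P, Hom(Hom(C, I), J))` is `Hom(P ⊗ Hom(C, I), J)`. The inner complex is
exact in positive degrees and `J` is injective. -/
theorem extVanishes_hom_hom (hC : IsSemidualizing C) {I J : ModuleCat.{u} R}
    (hI : Module.Injective R I) (hJ : Module.Injective R J) :
    ExtVanishes C (ModuleCat.of R ((C →ₗ[R] I) →ₗ[R] J)) := by
  obtain ⟨P, hP⟩ := hC.finite_resolution
  refine (extVanishes_iff P _).2 fun n f hf => ?_
  obtain ⟨ψ, hψ⟩ := exists_comp_eq_of_exact hJ (exact_rTensor_hom hC P hP hI n)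
    (TensorProduct.lift f.hom) (by
      refine TensorProduct.ext' fun x φ => ?_
      have := congrArg (fun k => k.hom x φ) hf
      simpa using this)
  refine ⟨ModuleCat.ofHom (TensorProduct.curry ψ), ?_⟩
  ext x φ
  simpa using LinearMap.congr_fun hψ (x ⊗ₜ φ)

/-! ### Evaluation, coevaluation and closure under retracts. -/

/-- The evaluation map `C ⊗ Hom(C, B) → B`. -/
def evaluation (C B : Type*) [AddCommGroup C] [Module R C] [AddCommGroup B] [Module R B] :
    C ⊗[R] (C →ₗ[R] B) →ₗ[R] B :=
  TensorProduct.lift LinearMap.applyₗ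

/-- The coevaluation map `B → Hom(C, C ⊗ B)`. -/
def coevaluation (C B : Type*) [AddCommGroup C] [Module R C] [AddCommGroup B] [Module R B] :
    B →ₗ[R] C →ₗ[R] C ⊗[R] B :=
  (TensorProduct.mk R C B).flip

/-- It is the composite `Q ≅ R ⊗ Q ≅ Hom(C, C) ⊗ Q ≅ Hom(C, C ⊗ Q)`. -/
theorem coevaluation_bijective (hC : IsSemidualizing C) (Q : Type u) [AddCommGroup Q] [Module R Q]
    [Module.Flat R Q] : Function.Bijective (coevaluation (R := R) C Q) := by
  obtain ⟨P, hP⟩ := hC.finite_resolution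
  have hproj : ∀ n, Module.Projective R (P.complex.X n) := fun n =>
    (IsProjective.iff_projective _).2 (P.projective n)
  have h := homTensor_bijective_of_presentation (D := C) (Q := Q)
    (exact_resolutionAugmentation P) (resolutionAugmentation_surjective P)
  let e := (TensorProduct.lid R Q).symm ≪≫ₗ
    TensorProduct.congr (LinearEquiv.ofBijective _ hC.homothety) (LinearEquiv.refl R Q) ≪≫ₗ
    LinearEquiv.ofBijective _ h
  have : coevaluation (R := R) C Q = e.toLinearMap := by
    ext q c
    simp [e, coevaluation]
  rw [this]
  exact e.bijective

/-- It is the composite `C ⊗ Hom(C, I) ≅ Hom(Hom(C, C), I) ≅ Hom(R, I) ≅ I`. -/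
theorem evaluation_bijective (hC : IsSemidualizing C) {I : Type u} [AddCommGroup I] [Module R I]
    (hI : Module.Injective R I) : Function.Bijective (evaluation (R := R) C I) := by
  obtain ⟨P, hP⟩ := hC.finite_resolution
  have hproj : ∀ n, Module.Projective R (P.complex.X n) := fun n =>
    (IsProjective.iff_projective _).2 (P.projective n)
  have h := tensorHom_bijective_of_presentation (D := C) hI
    (exact_resolutionAugmentation P) (resolutionAugmentation_surjective P)
  let e := LinearEquiv.ofBijective _ h ≪≫ₗ
    LinearEquiv.congrLeft I R (LinearEquiv.ofBijective _ hC.homothety).symm ≪≫ₗ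
    LinearMap.ringLmapEquivSelf R R I
  have : evaluation (R := R) C I = e.toLinearMap := by
    refine TensorProduct.ext' fun c φ => ?_
    simp [e, evaluation]
  rw [this]
  exact e.bijective

/-- Retracts of bijections are bijections. Applied to the naturality squares of evaluation and
coevaluation, this moves bijectivity to direct summands. -/
theorem bijective_of_retract {A B X Y : Type*} {u : A → B} {v : X → Y} (hv : Function.Bijective v)
    {i : A → X} {r : X → A} {j : B → Y} {s : Y → B} (hr : ∀ a, r (i a) = a) (hs : ∀ b, s (j b) = b)
    (h₁ : ∀ a, v (i a) = j (u a)) (h₂ : ∀ x, u (r x) = s (v x)) : Function.Bijective u := by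
  refine ⟨fun a b hab => ?_, fun b => ?_⟩
  · rw [← hr a, ← hr b]
    congr 1
    exact hv.1 (by rw [h₁, h₁, hab])
  · obtain ⟨x, hx⟩ := hv.2 (j b)
    exact ⟨r x, by rw [h₂, hx, hs]⟩

theorem evaluation_lTensor {B D : Type*} [AddCommGroup B] [Module R B] [AddCommGroup D]
    [Module R D] (g : B →ₗ[R] D) (t : C ⊗[R] (C →ₗ[R] B)) :
    evaluation C D ((LinearMap.compRight R g).lTensor C t) = g (evaluation C B t) := by
  induction t with
  | zero => simp
  | add x y hx hy => simp only [map_add, hx, hy]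
  | tmul c φ => simp [evaluation]

theorem coevaluation_apply_apply {B : Type*} [AddCommGroup B] [Module R B] (b : B) (c : C) :
    coevaluation (R := R) C B b c = c ⊗ₜ b := rfl

/-- By a triangle identity, evaluation is a one-sided inverse of `C ⊗ coevaluation`, which is
already an isomorphism. -/
theorem evaluation_tensor_bijective (hC : IsSemidualizing C) (Q : Type u) [AddCommGroup Q]
    [Module R Q] [Module.Flat R Q] : Function.Bijective (evaluation (R := R) C (C ⊗[R] Q)) := by
  let e := LinearEquiv.lTensor C (LinearEquiv.ofBijective _ (coevaluation_bijective hC Q))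
  have h : evaluation (R := R) C (C ⊗[R] Q) ∘ₗ e.toLinearMap = LinearMap.id := by
    refine TensorProduct.ext' fun c q => ?_
    simp [e, evaluation, coevaluation_apply_apply]
  have h' : evaluation (R := R) C (C ⊗[R] Q) = e.symm.toLinearMap := by
    refine LinearMap.ext fun t => ?_
    obtain ⟨t, rfl⟩ := e.surjective t
    rw [LinearEquiv.coe_coe, e.symm_apply_apply]
    exact LinearMap.congr_fun h t
  rw [h']
  exact e.symm.bijective

/-- This is the other triangle identity, with `Hom(C, evaluation)` as the known isomorphism. -/
theorem coevaluation_hom_bijective (hC : IsSemidualizing C) {I : Type u} [AddCommGroup I]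
    [Module R I] (hI : Module.Injective R I) :
    Function.Bijective (coevaluation (R := R) C (C →ₗ[R] I)) := by
  let e : (C →ₗ[R] C ⊗[R] (C →ₗ[R] I)) ≃ₗ[R] C →ₗ[R] I :=
    (LinearEquiv.ofBijective _ (evaluation_bijective hC hI)).congrRight
  have h : e.toLinearMap ∘ₗ coevaluation (R := R) C (C →ₗ[R] I) = LinearMap.id := by
    ext φ c
    simp [e, evaluation, coevaluation_apply_apply, LinearEquiv.congrRight]
  have h' : coevaluation (R := R) C (C →ₗ[R] I) = e.symm.toLinearMap := by
    ext1 φ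
    rw [LinearEquiv.coe_coe, e.eq_symm_apply]
    exact LinearMap.congr_fun h φ
  rw [h']
  exact e.symm.bijective

/-- Evaluation `C ⊗ Hom(C, B) → B` is bijective as a retract of the one for `C ⊗ Q`, and `Hom(C, B)`
is projective as a summand of `Hom(C, C ⊗ Q) ≅ Q`. -/
theorem isCProjective_of_retract (hC : IsSemidualizing C) {X B : ModuleCat.{u} R}
    (hX : IsCProjective C X) (i : B ⟶ X) (r : X ⟶ B) (h : i ≫ r = 𝟙 B) : IsCProjective C B := by
  obtain ⟨Q, hQ, ⟨e⟩⟩ := hX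
  let j : B →ₗ[R] C ⊗[R] Q := (i ≫ e.hom).hom
  let s : C ⊗[R] Q →ₗ[R] B := (e.inv ≫ r).hom
  have hjs : s ∘ₗ j = LinearMap.id := by
    rw [← ModuleCat.hom_comp, Category.assoc, Iso.hom_inv_id_assoc, h, ModuleCat.hom_id]
  have hcomp : LinearMap.compRight R (M := C) s ∘ₗ LinearMap.compRight R (M := C) j =
      LinearMap.id := by
    ext φ c
    exact LinearMap.congr_fun hjs (φ c)
  have hev : Function.Bijective (evaluation (R := R) C B) :=
    bijective_of_retract (evaluation_tensor_bijective hC Q)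
      (i := (LinearMap.compRight R j).lTensor C) (r := (LinearMap.compRight R s).lTensor C)
      (fun t => by rw [← LinearMap.comp_apply, ← LinearMap.lTensor_comp, hcomp,
        LinearMap.lTensor_id, LinearMap.id_apply])
      (LinearMap.congr_fun hjs) (evaluation_lTensor j) (evaluation_lTensor s)
  let ε := LinearEquiv.ofBijective _ (coevaluation_bijective hC Q)
  refine ⟨ModuleCat.of R (C →ₗ[R] B), ?_, ⟨(LinearEquiv.ofBijective _ hev).symm.toModuleIso⟩⟩
  refine Module.Projective.of_split (M := Q) (ε.symm.toLinearMap ∘ₗ LinearMap.compRight R j)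
    (LinearMap.compRight R s ∘ₗ ε.toLinearMap) ?_
  rw [LinearMap.comp_assoc, ← LinearMap.comp_assoc _ _ ε.toLinearMap, LinearEquiv.comp_symm,
    LinearMap.id_comp, hcomp]

/-- Dually, `B ≅ Hom(C, C ⊗ B)`, and `C ⊗ B` is injective as a retract of `C ⊗ Hom(C, I) ≅ I`. -/
theorem isCInjective_of_retract (hC : IsSemidualizing C) {X B : ModuleCat.{u} R}
    (hX : IsCInjective C X) (i : B ⟶ X) (r : X ⟶ B) (h : i ≫ r = 𝟙 B) : IsCInjective C B := by
  obtain ⟨I, hI, ⟨e⟩⟩ := hX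
  let j : B →ₗ[R] C →ₗ[R] I := (i ≫ e.hom).hom
  let s : (C →ₗ[R] I) →ₗ[R] B := (e.inv ≫ r).hom
  have hjs : s ∘ₗ j = LinearMap.id := by
    rw [← ModuleCat.hom_comp, Category.assoc, Iso.hom_inv_id_assoc, h, ModuleCat.hom_id]
  have hten : ∀ t, s.lTensor C (j.lTensor C t) = t := fun t => by
    rw [← LinearMap.comp_apply, ← LinearMap.lTensor_comp, hjs, LinearMap.lTensor_id,
      LinearMap.id_apply]
  have hcoev : Function.Bijective (coevaluation (R := R) C B) :=
    bijective_of_retract (coevaluation_hom_bijective hC hI) (i := j) (r := s)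
      (j := LinearMap.compRight R (j.lTensor C)) (s := LinearMap.compRight R (s.lTensor C))
      (LinearMap.congr_fun hjs) (fun φ => LinearMap.ext fun c => hten (φ c))
      (fun _ => rfl) (fun _ => rfl)
  let ε := LinearEquiv.ofBijective _ (evaluation_bijective hC hI)
  refine ⟨ModuleCat.of R (C ⊗[R] B), ⟨fun X Y _ _ _ _ f hf g => ?_⟩,
    ⟨(LinearEquiv.ofBijective _ hcoev).toModuleIso⟩⟩
  obtain ⟨k, hk⟩ := hI.out f hf (ε.toLinearMap ∘ₗ j.lTensor C ∘ₗ g)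
  refine ⟨s.lTensor C ∘ₗ ε.symm.toLinearMap ∘ₗ k, fun x => ?_⟩
  have h1 : k (f x) = ε (j.lTensor C (g x)) := hk x
  simp only [LinearMap.comp_apply, h1, LinearEquiv.coe_coe, ε.symm_apply_apply]
  exact hten _

end Semidualizing

/-! ### Properness versus exactness for bounded complexes. -/

section Properness

variable {R : Type u} [CommRing R] {C : ModuleCat.{u} R}

theorem Lifts.tensor_of_projective {Z : ChainComplex (ModuleCat.{u} R) ℕ} (h : Lifts C Z)
    (Q : ModuleCat.{u} R) (hQ : Module.Projective R Q) : Lifts (tensor C Q) Z := by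
  have key : ∀ {A B : ModuleCat.{u} R} (d : A ⟶ B) (f : tensor C Q ⟶ B),
      (∀ q : Q, ∃ g : C ⟶ A, g ≫ d = ModuleCat.ofHom ((TensorProduct.curry f.hom).flip q)) →
      ∃ g : tensor C Q ⟶ A, g ≫ d = f := by
    intro A B d f hf
    -- A map `C ⊗ Q → B` is a map `Q → Hom(C, B)`. Liftability at each `q` puts its image in the
    -- range of `p`, and projectivity of `Q` makes the lifts linear in `q`.
    let p : (C →ₗ[R] A) →ₗ[R] (C →ₗ[R] B) := LinearMap.compRight R d.hom
    obtain ⟨l, hl⟩ := Module.projective_lifting_property p.rangeRestrict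
      ((TensorProduct.curry f.hom).flip.codRestrict (LinearMap.range p) fun q => by
        obtain ⟨g, hg⟩ := hf q
        exact ⟨g.hom, congrArg ModuleCat.Hom.hom hg⟩) p.surjective_rangeRestrict
    refine ⟨ModuleCat.ofHom (TensorProduct.lift l.flip), ?_⟩
    ext : 1
    refine TensorProduct.ext' fun c q => ?_
    exact congrArg (fun φ => (φ q).1 c) hl
  refine ⟨fun f => key _ f fun q => h.1 _, fun n f hf => key _ f fun q => h.2 n _ ?_⟩
  ext c
  exact congrArg (fun φ => φ.hom (c ⊗ₜ q)) hf

theorem forall_homFrom_tensor_acyclic_iff (Z : ChainComplex (ModuleCat.{u} R) ℕ) :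
    (∀ Q : ModuleCat.{u} R, Module.Projective R Q → (homFrom (tensor C Q) Z).Acyclic) ↔
      Lifts C Z := by
  simp only [homFrom_acyclic_iff]
  exact ⟨fun h => (h (ModuleCat.of R R) inferInstance).of_iso
    (TensorProduct.rid R C).symm.toModuleIso, fun h => h.tensor_of_projective⟩

/-- The adjunction `Hom(A, Hom(C, J)) ≃ Hom(C, Hom(A, J))`. -/
def homSwap (A C J : ModuleCat.{u} R) : (A ⟶ hom C J) ≃ (C ⟶ ModuleCat.of R (A ⟶ J)) where
  toFun f := ModuleCat.ofHom ((ModuleCat.homLinearEquiv (S := R)).symm.toLinearMap ∘ₗ f.hom.flip)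
  invFun g := ModuleCat.ofHom ((ModuleCat.homLinearEquiv (S := R)).toLinearMap ∘ₗ g.hom).flip
  left_inv _ := rfl
  right_inv _ := rfl

theorem extends_hom_iff_lifts (Z : CochainComplex (ModuleCat.{u} R) ℕ) (J : ModuleCat.{u} R) :
    Extends Z (hom C J) ↔ Lifts C (homInto Z J) := by
  constructor
  · rintro ⟨h0, h1⟩
    refine ⟨fun f => ?_, fun n f hf => ?_⟩
    · obtain ⟨f, rfl⟩ := (homSwap _ C J).surjective f
      obtain ⟨g, rfl⟩ := h0 f
      exact ⟨homSwap _ C J g, rfl⟩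
    · obtain ⟨f, rfl⟩ := (homSwap _ C J).surjective f
      obtain ⟨g, rfl⟩ := h1 n f ((homSwap _ C J).injective hf)
      exact ⟨homSwap _ C J g, rfl⟩
  · rintro ⟨h0, h1⟩
    refine ⟨fun f => ?_, fun n f hf => ?_⟩
    · obtain ⟨g, hg⟩ := h0 (homSwap _ C J f)
      obtain ⟨g, rfl⟩ := (homSwap _ C J).surjective g
      exact ⟨g, (homSwap _ C J).injective hg⟩
    · obtain ⟨g, hg⟩ := h1 n (homSwap _ C J f) (congrArg (homSwap _ C J) hf)
      obtain ⟨g, rfl⟩ := (homSwap _ C J).surjective g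
      exact ⟨g, (homSwap _ C J).injective hg⟩

theorem acyclic_iff_ker_eq_range (Z : CochainComplex (ModuleCat.{u} R) ℕ) :
    Z.Acyclic ↔ Function.Injective (Z.d 0 1).hom ∧
      ∀ n, Function.Exact (Z.d n (n + 1)).hom (Z.d (n + 1) (n + 2)).hom := by
  have key : ∀ i j k, (ComplexShape.up ℕ).prev j = i → (ComplexShape.up ℕ).next j = k →
      (Z.ExactAt j ↔ LinearMap.range (Z.d i j).hom = LinearMap.ker (Z.d j k).hom) := by
    intro i j k hi hk
    rw [HomologicalComplex.exactAt_iff' _ i j k hi hk,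
      ShortComplex.moduleCat_exact_iff_range_eq_ker]
    rfl
  have h0 : LinearMap.range (Z.d 0 0).hom = ⊥ := by
    rw [Z.shape 0 0 (by simp), ModuleCat.hom_zero, LinearMap.range_zero]
  simp only [LinearMap.exact_iff, ← LinearMap.ker_eq_bot]
  constructor
  · exact fun h => ⟨h0 ▸ ((key 0 0 1 (by simp) (by simp)).1 (h 0)).symm,
      fun n => ((key n (n + 1) (n + 2) (by simp) (by simp)).1 (h (n + 1))).symm⟩
  · rintro ⟨h, h'⟩ (_ | n)
    · exact (key 0 0 1 (by simp) (by simp)).2 (h0.trans h.symm)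
    · exact (key n (n + 1) (n + 2) (by simp) (by simp)).2 (h' n).symm

theorem exists_injective_embedding (D : ModuleCat.{u} R) :
    ∃ (J : ModuleCat.{u} R) (ι : D ⟶ J), Module.Injective R J ∧ Function.Injective ι.hom :=
  ⟨Injective.under D, Injective.ι D, Module.injective_module_of_injective_object
    (inj := inferInstanceAs (Injective (Injective.under D))) R _,
    (ModuleCat.mono_iff_injective _).1 inferInstance⟩

/-- A cochain complex is acyclic if and only if all maps from it to injective modules extend. -/
theorem acyclic_iff_forall_extends (Z : CochainComplex (ModuleCat.{u} R) ℕ) :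
    Z.Acyclic ↔ ∀ J : ModuleCat.{u} R, Module.Injective R J → Extends Z J := by
  rw [acyclic_iff_ker_eq_range]
  constructor
  · rintro ⟨h0, h1⟩ J hJ
    refine ⟨fun f => ?_, fun n f hf => ?_⟩
    · obtain ⟨g, hg⟩ := hJ.out _ h0 f.hom
      exact ⟨ModuleCat.ofHom g, ModuleCat.hom_ext (LinearMap.ext hg)⟩
    · obtain ⟨g, hg⟩ := exists_comp_eq_of_exact hJ (h1 n) f.hom (congrArg ModuleCat.Hom.hom hf)
      exact ⟨ModuleCat.ofHom g, ModuleCat.hom_ext hg⟩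
  · intro h
    constructor
    · obtain ⟨J, ι, hJ, hι⟩ := exists_injective_embedding (Z.X 0)
      obtain ⟨g, hg⟩ := (h J hJ).1 ι
      intro x y hxy
      refine hι ?_
      rw [← hg]
      exact congrArg g.hom hxy
    · intro n x
      refine ⟨fun hx => ?_, ?_⟩
      · obtain ⟨J, ι, hJ, hι⟩ := exists_injective_embedding
          (ModuleCat.of R (Z.X (n + 1) ⧸ LinearMap.range (Z.d n (n + 1)).hom))
        obtain ⟨g, hg⟩ := (h J hJ).2 n (ModuleCat.ofHom (Submodule.mkQ _) ≫ ι) (by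
          ext y
          have : (LinearMap.range (Z.d n (n + 1)).hom).mkQ ((Z.d n (n + 1)).hom y) = 0 :=
            (Submodule.Quotient.mk_eq_zero _).2 ⟨y, rfl⟩
          exact (congrArg ι.hom this).trans (map_zero _))
        have h1 : ι.hom ((LinearMap.range (Z.d n (n + 1)).hom).mkQ x) = 0 := by
          refine (congrArg (fun k => k.hom x) hg).symm.trans ?_
          exact (congrArg g.hom hx).trans (map_zero _)
        exact (Submodule.Quotient.mk_eq_zero _).1 (hι (h1.trans (map_zero _).symm))
      · rintro ⟨y, rfl⟩
        exact congrArg (fun k => k.hom y) (Z.d_comp_d n (n + 1) (n + 2))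

theorem isCProjective_of_isZero {X : ModuleCat.{u} R} (hX : IsZero X) : IsCProjective C X :=
  ⟨ModuleCat.of R PUnit, inferInstance, ⟨hX.iso (ModuleCat.isZero_of_subsingleton _)⟩⟩

theorem isCInjective_of_isZero {X : ModuleCat.{u} R} (hX : IsZero X) : IsCInjective C X :=
  ⟨ModuleCat.of R PUnit, ⟨fun _ _ _ _ _ _ _ _ _ => ⟨0, fun _ => rfl⟩⟩,
    ⟨hX.iso (ModuleCat.isZero_of_subsingleton _)⟩⟩

/-- For a bounded augmented complex of modules in `𝒫_C`, properness and exactness agree. -/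
theorem forall_homFrom_acyclic_iff_acyclic (hC : IsSemidualizing C) {M : ModuleCat.{u} R}
    (X : ChainComplex (ModuleCat.{u} R) ℕ) (ε : X.X 0 ⟶ M) (w : X.d 1 0 ≫ ε = 0)
    (hX : ∀ n, IsCProjective C (X.X n)) (N : ℕ) (hN : ∀ n, N ≤ n → IsZero (X.X n)) :
    (∀ Q : ModuleCat.{u} R, Module.Projective R Q →
      (homFrom (tensor C Q) (X.augment ε w)).Acyclic) ↔ (X.augment ε w).Acyclic := by
  rw [forall_homFrom_tensor_acyclic_iff]
  -- The augmentation shifts degrees by one: `X_n` is the term of index `n + 1`, and `M`, in index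
  -- `0`, is the term on which nothing is assumed.
  exact lifts_iff_acyclic hC.subsingleton_of_hom_eq_zero _
    (fun n => extVanishes_of_isCProjective hC (hX n)) N hN

/-- For a bounded augmented complex of modules in `ℐ_C`, properness and exactness agree. -/
theorem forall_homInto_acyclic_iff_acyclic (hC : IsSemidualizing C) {M : ModuleCat.{u} R}
    (Y : CochainComplex (ModuleCat.{u} R) ℕ) (η : M ⟶ Y.X 0) (w : η ≫ Y.d 0 1 = 0)
    (hY : ∀ n, IsCInjective C (Y.X n)) (N : ℕ) (hN : ∀ n, N ≤ n → IsZero (Y.X n)) :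
    (∀ J : ModuleCat.{u} R, Module.Injective R J →
      (homInto (Y.augment η w) (hom C J)).Acyclic) ↔ (Y.augment η w).Acyclic := by
  rw [acyclic_iff_forall_extends]
  refine forall₂_congr fun J hJ => ?_
  rw [homInto_acyclic_iff, extends_hom_iff_lifts, ← homInto_acyclic_iff]
  refine lifts_iff_acyclic hC.subsingleton_of_hom_eq_zero _ (fun n => ?_) N fun n hn => ?_
  · obtain ⟨I, hI, ⟨e⟩⟩ := hY n
    refine (extVanishes_hom_hom hC hI hJ).of_iso (LinearEquiv.toModuleIso ?_)
    exact (e.toLinearEquiv.congrLeft J R).symm ≪≫ₗ (ModuleCat.homLinearEquiv (S := R)).symm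
  · have := hN n hn
    refine @ModuleCat.isZero_of_subsingleton _ _ _ ⟨fun a b => ?_⟩
    exact this.eq_of_src (Y := J) a b

theorem hasProjSequence_iff (hC : IsSemidualizing C) (M : ModuleCat.{u} R) (n : ℕ) :
    HasProjSequence C M n ↔ ∃ X : ProperProjRes C M, ∀ i, n < i → IsZero (X.complex.X i) := by
  constructor
  · rintro ⟨X, ε, w, hac, hX, hz⟩
    have hX' : ∀ i, IsCProjective C (X.X i) := fun i =>
      (le_or_gt i n).elim (hX i) fun h => isCProjective_of_isZero (hz i h)
    exact ⟨⟨X, ε, w, hX', (forall_homFrom_acyclic_iff_acyclic hC X ε w hX' (n + 1) hz).2 hac⟩, hz⟩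
  · rintro ⟨X, hz⟩
    exact ⟨X.complex, X.ε, X.d_ε, (forall_homFrom_acyclic_iff_acyclic hC _ _ _ X.cproj
      (n + 1) hz).1 X.proper, fun i _ => X.cproj i, hz⟩

theorem hasInjSequence_iff (hC : IsSemidualizing C) (N : ModuleCat.{u} R) (n : ℕ) :
    HasInjSequence C N n ↔ ∃ Y : ProperInjRes C N, ∀ i, n < i → IsZero (Y.complex.X i) := by
  constructor
  · rintro ⟨Y, η, w, hac, hY, hz⟩
    have hY' : ∀ i, IsCInjective C (Y.X i) := fun i =>
      (le_or_gt i n).elim (hY i) fun h => isCInjective_of_isZero (hz i h)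
    exact ⟨⟨Y, η, w, hY', (forall_homInto_acyclic_iff_acyclic hC Y η w hY' (n + 1) hz).2 hac⟩, hz⟩
  · rintro ⟨Y, hz⟩
    exact ⟨Y.complex, Y.η, Y.η_d, (forall_homInto_acyclic_iff_acyclic hC _ _ _ Y.cinj
      (n + 1) hz).1 Y.proper, fun i _ => Y.cinj i, hz⟩

/-! ### Bounds on the dimensions. -/

theorem length_le_iff {c : ComplexShape ℕ} (X : HomologicalComplex (ModuleCat.{u} R) c) (n : ℕ) :
    length X ≤ ((n : ℕ∞) : WithBot ℕ∞) ↔ ∀ i, n < i → IsZero (X.X i) := by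
  rw [length, iSup₂_le_iff]
  refine forall_congr' fun i => ?_
  rw [WithBot.coe_le_coe, Nat.cast_le, ← not_lt]
  tauto

/-- Weakening to the strict bound `n + 1` produces a member of the family, and a value below `n + 1`
is at most `n`. -/
theorem exists_le_of_iInf_le {ι : Type*} (f : ι → WithBot ℕ∞) (n : ℕ)
    (h : ⨅ i, f i ≤ ((n : ℕ∞) : WithBot ℕ∞)) : ∃ i, f i ≤ ((n : ℕ∞) : WithBot ℕ∞) := by
  have hlt : ⨅ i, f i < (((n + 1 : ℕ) : ℕ∞) : WithBot ℕ∞) :=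
    h.trans_lt (WithBot.coe_lt_coe.2 (Nat.cast_lt.2 n.lt_succ_self))
  obtain ⟨i, hi⟩ := iInf_lt_iff.1 hlt
  refine ⟨i, ?_⟩
  generalize f i = a at hi
  induction a with
  | bot => exact bot_le
  | coe a =>
    rw [WithBot.coe_lt_coe, Nat.cast_add, Nat.cast_one] at hi
    exact WithBot.coe_le_coe.2 (Order.le_of_lt_add_one hi)

theorem projDim_le_iff (M : ModuleCat.{u} R) (n : ℕ) :
    projDim C M ≤ ((n : ℕ∞) : WithBot ℕ∞) ↔
      ∃ X : ProperProjRes C M, ∀ i, n < i → IsZero (X.complex.X i) := by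
  simp only [← length_le_iff]
  exact ⟨exists_le_of_iInf_le _ n, fun ⟨X, hX⟩ => (iInf_le _ X).trans hX⟩

theorem injDim_le_iff (N : ModuleCat.{u} R) (n : ℕ) :
    injDim C N ≤ ((n : ℕ∞) : WithBot ℕ∞) ↔
      ∃ Y : ProperInjRes C N, ∀ i, n < i → IsZero (Y.complex.X i) := by
  simp only [← length_le_iff]
  exact ⟨exists_le_of_iInf_le _ n, fun ⟨Y, hY⟩ => (iInf_le _ Y).trans hY⟩

end Properness

/-! ### Truncating proper resolutions. -/

section Truncation

variable {R : Type u} [CommRing R] {C : ModuleCat.{u} R}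

theorem d_d_apply {c : ComplexShape ℕ} (Z : HomologicalComplex (ModuleCat.{u} R) c) (i j k : ℕ)
    (x : Z.X i) : (Z.d j k).hom ((Z.d i j).hom x) = 0 :=
  congrArg (fun f => f.hom x) (Z.d_comp_d i j k)

theorem lifts_augment_iff {A M : ModuleCat.{u} R} (X : ChainComplex (ModuleCat.{u} R) ℕ)
    (ε : X.X 0 ⟶ M) (w : X.d 1 0 ≫ ε = 0) :
    Lifts A (X.augment ε w) ↔ (∀ f : A ⟶ M, ∃ g : A ⟶ X.X 0, g ≫ ε = f) ∧
      (∀ f : A ⟶ X.X 0, f ≫ ε = 0 → ∃ g : A ⟶ X.X 1, g ≫ X.d 1 0 = f) ∧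
      ∀ n, ∀ f : A ⟶ X.X (n + 1), f ≫ X.d (n + 1) n = 0 →
        ∃ g : A ⟶ X.X (n + 2), g ≫ X.d (n + 2) (n + 1) = f :=
  ⟨fun h => ⟨h.1, h.2 0, fun n => h.2 (n + 1)⟩,
    fun h => ⟨h.1, fun n => n.casesOn h.2.1 h.2.2⟩⟩

theorem extends_augment_iff {N B : ModuleCat.{u} R} (Y : CochainComplex (ModuleCat.{u} R) ℕ)
    (η : N ⟶ Y.X 0) (w : η ≫ Y.d 0 1 = 0) :
    Extends (Y.augment η w) B ↔ (∀ f : N ⟶ B, ∃ g : Y.X 0 ⟶ B, η ≫ g = f) ∧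
      (∀ f : Y.X 0 ⟶ B, η ≫ f = 0 → ∃ g : Y.X 1 ⟶ B, Y.d 0 1 ≫ g = f) ∧
      ∀ n, ∀ f : Y.X (n + 1) ⟶ B, Y.d n (n + 1) ≫ f = 0 →
        ∃ g : Y.X (n + 2) ⟶ B, Y.d (n + 1) (n + 2) ≫ g = f :=
  ⟨fun h => ⟨h.1, h.2 0, fun n => h.2 (n + 1)⟩,
    fun h => ⟨h.1, fun n => n.casesOn h.2.1 h.2.2⟩⟩

/-- The quotient of a chain complex by a family of submodules stable under the differential. -/
def quotientComplex (X : ChainComplex (ModuleCat.{u} R) ℕ) (T : ∀ i, Submodule R (X.X i))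
    (hT : ∀ i j, T i ≤ (T j).comap (X.d i j).hom) : ChainComplex (ModuleCat.{u} R) ℕ where
  X i := ModuleCat.of R (X.X i ⧸ T i)
  d i j := ModuleCat.ofHom (Submodule.mapQ _ _ (X.d i j).hom (hT i j))
  shape i j hij := by
    ext x
    simp [X.shape i j hij]
  d_comp_d' i j k _ _ := by
    ext x
    exact (congrArg (Submodule.mkQ (T k)) (d_d_apply X i j k x)).trans (map_zero _)

/-- The subcomplex of a cochain complex on a family of submodules stable under the
differential. -/
def subComplex (Y : CochainComplex (ModuleCat.{u} R) ℕ) (T : ∀ i, Submodule R (Y.X i))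
    (hT : ∀ i j, T i ≤ (T j).comap (Y.d i j).hom) : CochainComplex (ModuleCat.{u} R) ℕ where
  X i := ModuleCat.of R (T i)
  d i j := ModuleCat.ofHom ((Y.d i j).hom.restrict (hT i j))
  shape i j hij := by
    ext x
    simp [Y.shape i j hij]
  d_comp_d' i j k _ _ := by
    ext x
    exact d_d_apply Y i j k x.1

/-- The surjection of `X_{n+1}` onto the image of its differential is a cocycle. Vanishing of its
class extends it to `X_n`, and the extension retracts `X_n` onto this image. -/
theorem exists_retraction_of_isZero_extProj {M : ModuleCat.{u} R} (X : ProperProjRes C M) (n : ℕ)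
    (h : ∀ N : ModuleCat.{u} R, IsZero (extProj C M N (n + 1))) :
    ∃ s : X.complex.X n ⟶ ModuleCat.of R (LinearMap.range (X.complex.d (n + 1) n).hom),
      X.complex.d (n + 1) n ≫ s = ModuleCat.ofHom (X.complex.d (n + 1) n).hom.rangeRestrict := by
  set N := ModuleCat.of R (LinearMap.range (X.complex.d (n + 1) n).hom)
  obtain ⟨e⟩ := X.nonempty_extProj_iso N (n + 1)
  have hz : (homInto X.complex N).ExactAt (n + 1) := by
    rw [HomologicalComplex.exactAt_iff_isZero_homology]
    exact (h N).of_iso e.symm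
  rw [HomologicalComplex.exactAt_iff' (homInto X.complex N) n (n + 1) (n + 2)
    (show (ComplexShape.down ℕ).next (n + 1) = n by simp)
    (show (ComplexShape.down ℕ).prev (n + 1) = n + 2 by simp),
    ShortComplex.moduleCat_exact_iff] at hz
  refine hz (ModuleCat.ofHom (X.complex.d (n + 1) n).hom.rangeRestrict) ?_
  change X.complex.d (n + 2) (n + 1) ≫
    ModuleCat.ofHom (X.complex.d (n + 1) n).hom.rangeRestrict = 0
  ext x
  exact congrArg (fun k => k.hom x) (X.complex.d_comp_d (n + 2) (n + 1) n)

/-- The inclusion of the kernel into `Y^{n+1}` is a cocycle; a cochain bounding it is the required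
map. -/
theorem exists_section_of_isZero_extInj {N : ModuleCat.{u} R} (Y : ProperInjRes C N) (n : ℕ)
    (h : ∀ M : ModuleCat.{u} R, IsZero (extInj C M N (n + 1))) :
    ∃ s : ModuleCat.of R (LinearMap.ker (Y.complex.d (n + 1) (n + 2)).hom) ⟶ Y.complex.X n,
      s ≫ Y.complex.d n (n + 1) = ModuleCat.ofHom (Submodule.subtype _) := by
  set M := ModuleCat.of R (LinearMap.ker (Y.complex.d (n + 1) (n + 2)).hom)
  obtain ⟨e⟩ := Y.nonempty_extInj_iso M (n + 1)
  have hz : (homFrom M Y.complex).ExactAt (n + 1) := by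
    rw [HomologicalComplex.exactAt_iff_isZero_homology]
    exact (h M).of_iso e.symm
  rw [HomologicalComplex.exactAt_iff' _ n (n + 1) (n + 2) (by simp) (by simp),
    ShortComplex.moduleCat_exact_iff] at hz
  refine hz (ModuleCat.ofHom (Submodule.subtype _)) ?_
  change ModuleCat.ofHom (Submodule.subtype _) ≫ Y.complex.d (n + 1) (n + 2) = 0
  ext x
  exact x.2

/-- The submodules to be factored out in order to truncate a chain complex in degree `n`. -/
def upperSubmodule (X : ChainComplex (ModuleCat.{u} R) ℕ) (n i : ℕ) : Submodule R (X.X i) :=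
  if i < n then ⊥ else if i = n then LinearMap.range (X.d (i + 1) i).hom else ⊤

theorem upperSubmodule_le_range (X : ChainComplex (ModuleCat.{u} R) ℕ) {n i : ℕ} (h : i ≤ n) :
    upperSubmodule X n i ≤ LinearMap.range (X.d (i + 1) i).hom := by
  unfold upperSubmodule
  split_ifs
  · exact bot_le
  · exact le_rfl
  · lia

theorem upperSubmodule_eq_bot (X : ChainComplex (ModuleCat.{u} R) ℕ) {n i : ℕ} (h : i < n) :
    upperSubmodule X n i = ⊥ := if_pos h

theorem upperSubmodule_self (X : ChainComplex (ModuleCat.{u} R) ℕ) (n : ℕ) :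
    upperSubmodule X n n = LinearMap.range (X.d (n + 1) n).hom := by
  simp [upperSubmodule]

theorem upperSubmodule_eq_top (X : ChainComplex (ModuleCat.{u} R) ℕ) {n i : ℕ} (h : n < i) :
    upperSubmodule X n i = ⊤ := by
  rw [upperSubmodule, if_neg (by lia), if_neg (by lia)]

theorem upperSubmodule_le_comap (X : ChainComplex (ModuleCat.{u} R) ℕ) (n i j : ℕ) :
    upperSubmodule X n i ≤ (upperSubmodule X n j).comap (X.d i j).hom := by
  by_cases hij : j + 1 = i
  · subst hij
    rcases lt_trichotomy j n with h | rfl | h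
    · intro x hx
      obtain ⟨y, rfl⟩ := upperSubmodule_le_range X (by lia) hx
      rw [Submodule.mem_comap, d_d_apply]
      exact zero_mem _
    · rw [upperSubmodule_self]
      exact fun x _ => ⟨x, rfl⟩
    · rw [upperSubmodule_eq_top X h]
      exact fun _ _ => Submodule.mem_top
  · intro x _
    rw [Submodule.mem_comap, X.shape i j (by simpa using hij)]
    exact zero_mem _

/-- The submodules forming the truncation of a cochain complex in degree `n`. -/
def lowerSubmodule (Y : CochainComplex (ModuleCat.{u} R) ℕ) (n i : ℕ) : Submodule R (Y.X i) :=
  if i < n then ⊤ else if i = n then LinearMap.ker (Y.d i (i + 1)).hom else ⊥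

theorem ker_le_lowerSubmodule (Y : CochainComplex (ModuleCat.{u} R) ℕ) {n i : ℕ} (h : i ≤ n) :
    LinearMap.ker (Y.d i (i + 1)).hom ≤ lowerSubmodule Y n i := by
  unfold lowerSubmodule
  split_ifs
  · exact le_top
  · exact le_rfl
  · lia

theorem lowerSubmodule_eq_top (Y : CochainComplex (ModuleCat.{u} R) ℕ) {n i : ℕ} (h : i < n) :
    lowerSubmodule Y n i = ⊤ := if_pos h

theorem lowerSubmodule_self (Y : CochainComplex (ModuleCat.{u} R) ℕ) (n : ℕ) :
    lowerSubmodule Y n n = LinearMap.ker (Y.d n (n + 1)).hom := by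
  simp [lowerSubmodule]

theorem lowerSubmodule_eq_bot (Y : CochainComplex (ModuleCat.{u} R) ℕ) {n i : ℕ} (h : n < i) :
    lowerSubmodule Y n i = ⊥ := by
  rw [lowerSubmodule, if_neg (by lia), if_neg (by lia)]

theorem lowerSubmodule_le_comap (Y : CochainComplex (ModuleCat.{u} R) ℕ) (n i j : ℕ) :
    lowerSubmodule Y n i ≤ (lowerSubmodule Y n j).comap (Y.d i j).hom := by
  by_cases hij : i + 1 = j
  · subst hij
    rcases lt_trichotomy i n with h | rfl | h
    · intro x _
      exact ker_le_lowerSubmodule Y (by lia) (d_d_apply Y i (i + 1) (i + 1 + 1) x)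
    · rw [lowerSubmodule_self]
      intro x hx
      rw [Submodule.mem_comap, hx]
      exact zero_mem _
    · rw [lowerSubmodule_eq_bot Y h]
      exact bot_le
  · intro x _
    rw [Submodule.mem_comap, Y.shape i j (by simpa using hij)]
    exact zero_mem _

theorem exists_section_mkQ_upperSubmodule (X : ChainComplex (ModuleCat.{u} R) ℕ) {n : ℕ}
    (s : X.X n ⟶ ModuleCat.of R (LinearMap.range (X.d (n + 1) n).hom))
    (hs : X.d (n + 1) n ≫ s = ModuleCat.ofHom (X.d (n + 1) n).hom.rangeRestrict) {i : ℕ}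
    (hi : i ≤ n) : ∃ σ : ModuleCat.of R (X.X i ⧸ upperSubmodule X n i) ⟶ X.X i,
      σ ≫ ModuleCat.ofHom (upperSubmodule X n i).mkQ = 𝟙 _ := by
  suffices ∃ p : X.X i →ₗ[R] X.X i, upperSubmodule X n i ≤ LinearMap.ker p ∧
      ∀ x, p x - x ∈ upperSubmodule X n i by
    obtain ⟨p, hp, hp'⟩ := this
    refine ⟨ModuleCat.ofHom (Submodule.liftQ _ p hp), ?_⟩
    ext x
    exact (Submodule.Quotient.eq _).2 (hp' x)
  rcases hi.lt_or_eq with hi | rfl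
  · rw [upperSubmodule_eq_bot X hi]
    exact ⟨LinearMap.id, bot_le, fun x => by simp⟩
  · rw [upperSubmodule_self]
    -- The complementary projection to the retraction `s` kills the image and differs from the
    -- identity by elements of it.
    refine ⟨LinearMap.id - Submodule.subtype _ ∘ₗ s.hom, ?_, fun x => ?_⟩
    · rintro _ ⟨y, rfl⟩
      have : s.hom ((X.d (i + 1) i).hom y) = (X.d (i + 1) i).hom.rangeRestrict y :=
        congrArg (fun k => k.hom y) hs
      simp [this]
    · simp

theorem exists_retraction_lowerSubmodule (Y : CochainComplex (ModuleCat.{u} R) ℕ) {n : ℕ}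
    (s : ModuleCat.of R (LinearMap.ker (Y.d (n + 1) (n + 2)).hom) ⟶ Y.X n)
    (hs : s ≫ Y.d n (n + 1) = ModuleCat.ofHom (Submodule.subtype _)) {i : ℕ}
    (hi : i ≤ n) : ∃ ρ : Y.X i ⟶ ModuleCat.of R (lowerSubmodule Y n i),
      ModuleCat.ofHom (lowerSubmodule Y n i).subtype ≫ ρ = 𝟙 _ := by
  suffices ∃ p : Y.X i →ₗ[R] Y.X i, (∀ x, p x ∈ lowerSubmodule Y n i) ∧
      ∀ x ∈ lowerSubmodule Y n i, p x = x by
    obtain ⟨p, hp, hp'⟩ := this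
    refine ⟨ModuleCat.ofHom (p.codRestrict _ hp), ?_⟩
    ext x
    exact hp' x.1 x.2
  rcases hi.lt_or_eq with hi | rfl
  · rw [lowerSubmodule_eq_top Y hi]
    exact ⟨LinearMap.id, fun _ => Submodule.mem_top, fun x _ => rfl⟩
  · rw [lowerSubmodule_self]
    -- Since `d ∘ s` is the inclusion, `d ∘ (1 - s ∘ d) = 0`; on `ker d` the correction term
    -- vanishes.
    refine ⟨LinearMap.id - s.hom ∘ₗ (Y.d i (i + 1)).hom.codRestrict _ (fun x =>
      d_d_apply Y i (i + 1) (i + 2) x), fun x => ?_, fun x hx => ?_⟩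
    · have : ∀ y, (Y.d i (i + 1)).hom (s.hom y) = y.1 := fun y =>
        congrArg (fun k => k.hom y) hs
      rw [LinearMap.mem_ker, LinearMap.sub_apply, map_sub, LinearMap.comp_apply, this]
      exact sub_self _
    · have : (Y.d i (i + 1)).hom.codRestrict (LinearMap.ker (Y.d (i + 1) (i + 2)).hom) (fun x =>
          d_d_apply Y i (i + 1) (i + 2) x) x = 0 := Subtype.ext hx
      rw [LinearMap.sub_apply, LinearMap.comp_apply, this, map_zero, sub_zero, LinearMap.id_apply]

/-- Vanishing of `Ext^{n+1}_{𝒫_C}(M, -)` allows to truncate proper resolutions. -/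
theorem exists_properProjRes_of_isZero_extProj (hC : IsSemidualizing C) {M : ModuleCat.{u} R}
    (n : ℕ) (h : ∀ N : ModuleCat.{u} R, IsZero (extProj C M N (n + 1))) :
    ∃ X : ProperProjRes C M, ∀ i, n < i → IsZero (X.complex.X i) := by
  let X : ProperProjRes C M := Classical.arbitrary _
  obtain ⟨s, hs⟩ := exists_retraction_of_isZero_extProj X n h
  let T := upperSubmodule X.complex n
  let X' := quotientComplex X.complex T (upperSubmodule_le_comap X.complex n)
  let q : ∀ i, X.complex.X i ⟶ X'.X i := fun i => ModuleCat.ofHom (T i).mkQ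
  have hqd : ∀ i j, q i ≫ X'.d i j = X.complex.d i j ≫ q j := fun i j => rfl
  have hqepi : ∀ i, Epi (q i) := fun i =>
    (ModuleCat.epi_iff_surjective _).2 (Submodule.mkQ_surjective _)
  have hqmono : ∀ i, i < n → Mono (q i) := fun i hi => by
    rw [ModuleCat.mono_iff_injective, ← LinearMap.ker_eq_bot]
    exact (Submodule.ker_mkQ _).trans (upperSubmodule_eq_bot X.complex hi)
  have hzero : ∀ i, n < i → IsZero (X'.X i) := fun i hi => by
    have : Subsingleton (X.complex.X i ⧸ T i) :=
      Submodule.Quotient.subsingleton_iff.2 (upperSubmodule_eq_top X.complex hi)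
    exact ModuleCat.isZero_of_subsingleton (ModuleCat.of R (X.complex.X i ⧸ T i))
  have hsec : ∀ i, i ≤ n → ∃ σ : X'.X i ⟶ X.complex.X i, σ ≫ q i = 𝟙 _ := fun i hi =>
    exists_section_mkQ_upperSubmodule X.complex s hs hi
  have hε : T 0 ≤ LinearMap.ker X.ε.hom := (upperSubmodule_le_range _ (Nat.zero_le n)).trans (by
    rintro _ ⟨y, rfl⟩
    exact congrArg (fun k => k.hom y) X.d_ε)
  let ε' : X'.X 0 ⟶ M := ModuleCat.ofHom (Submodule.liftQ _ X.ε.hom hε)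
  have hqε : q 0 ≫ ε' = X.ε := rfl
  have w : X'.d 1 0 ≫ ε' = 0 := by
    rw [← cancel_epi (q 1), reassoc_of% (hqd 1 0), hqε, X.d_ε, comp_zero]
  obtain ⟨hl, hl₀, hl₁⟩ := (lifts_augment_iff _ _ _).1
    ((forall_homFrom_tensor_acyclic_iff _).1 X.proper)
  refine ⟨⟨X', ε', w, fun i => ?_, (forall_homFrom_tensor_acyclic_iff _).2
    ((lifts_augment_iff _ _ _).2 ⟨fun f => ?_, fun f hf => ?_, fun k f hf => ?_⟩)⟩, hzero⟩
  · rcases le_or_gt i n with hi | hi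
    · obtain ⟨σ, hσ⟩ := hsec i hi
      exact isCProjective_of_retract hC (X.cproj i) σ (q i) hσ
    · exact isCProjective_of_isZero (hzero i hi)
  · obtain ⟨g, hg⟩ := hl f
    exact ⟨g ≫ q 0, by rw [Category.assoc, hqε, hg]⟩
  · obtain ⟨σ, hσ⟩ := hsec 0 (Nat.zero_le n)
    -- Lifting in the truncation: move to `X` by the section, lift there, and return by the quotient
    -- map.
    obtain ⟨g, hg⟩ := hl₀ (f ≫ σ) (by rw [← hqε, Category.assoc, reassoc_of% hσ, hf])
    exact ⟨g ≫ q 1, by rw [Category.assoc, hqd, reassoc_of% hg, hσ, Category.comp_id]⟩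
  · rcases le_or_gt (k + 1) n with hk | hk
    · obtain ⟨σ, hσ⟩ := hsec (k + 1) hk
      have := hqmono k hk
      -- That `f ≫ σ` is a cycle may be checked after `q k`, a monomorphism because `k < n`.
      obtain ⟨g, hg⟩ := hl₁ k (f ≫ σ) (by
        rw [← cancel_mono (q k), Category.assoc, Category.assoc, ← hqd, reassoc_of% hσ, hf,
          zero_comp])
      exact ⟨g ≫ q (k + 2), by rw [Category.assoc, hqd, reassoc_of% hg, hσ, Category.comp_id]⟩
    · exact ⟨0, (hzero _ hk).eq_of_tgt _ _⟩

/-- Vanishing of `Ext^{n+1}_{ℐ_C}(-, N)` allows to truncate proper resolutions. -/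
theorem exists_properInjRes_of_isZero_extInj (hC : IsSemidualizing C) {N : ModuleCat.{u} R}
    (n : ℕ) (h : ∀ M : ModuleCat.{u} R, IsZero (extInj C M N (n + 1))) :
    ∃ Y : ProperInjRes C N, ∀ i, n < i → IsZero (Y.complex.X i) := by
  let Y : ProperInjRes C N := Classical.arbitrary _
  obtain ⟨s, hs⟩ := exists_section_of_isZero_extInj Y n h
  let T := lowerSubmodule Y.complex n
  let Y' := subComplex Y.complex T (lowerSubmodule_le_comap Y.complex n)
  let q : ∀ i, Y'.X i ⟶ Y.complex.X i := fun i => ModuleCat.ofHom (T i).subtype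
  have hqd : ∀ i j, q i ≫ Y.complex.d i j = Y'.d i j ≫ q j := fun i j => rfl
  have hqmono : ∀ i, Mono (q i) := fun i =>
    (ModuleCat.mono_iff_injective _).2 (Submodule.subtype_injective _)
  have hqepi : ∀ i, i < n → Epi (q i) := fun i hi => by
    rw [ModuleCat.epi_iff_surjective, ← LinearMap.range_eq_top]
    exact (Submodule.range_subtype _).trans (lowerSubmodule_eq_top Y.complex hi)
  have hzero : ∀ i, n < i → IsZero (Y'.X i) := fun i hi => by
    have : Subsingleton (T i) :=
      Submodule.subsingleton_iff_eq_bot.2 (lowerSubmodule_eq_bot Y.complex hi)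
    exact ModuleCat.isZero_of_subsingleton (ModuleCat.of R (T i))
  have hret : ∀ i, i ≤ n → ∃ ρ : Y.complex.X i ⟶ Y'.X i, q i ≫ ρ = 𝟙 _ := fun i hi =>
    exists_retraction_lowerSubmodule Y.complex s hs hi
  have hη : ∀ x, (Y.complex.d 0 1).hom (Y.η.hom x) = 0 := fun x =>
    congrArg (fun k => k.hom x) Y.η_d
  let η' : N ⟶ Y'.X 0 := ModuleCat.ofHom (Y.η.hom.codRestrict (T 0) fun x =>
    ker_le_lowerSubmodule _ (Nat.zero_le n) (hη x))
  have hqη : η' ≫ q 0 = Y.η := rfl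
  have w : η' ≫ Y'.d 0 1 = 0 := by
    rw [← cancel_mono (q 1), Category.assoc, ← hqd 0 1, reassoc_of% hqη, Y.η_d, zero_comp]
  refine ⟨⟨Y', η', w, fun i => ?_, fun J hJ => (homInto_acyclic_iff _ _).2 ?_⟩, hzero⟩
  · rcases le_or_gt i n with hi | hi
    · obtain ⟨ρ, hρ⟩ := hret i hi
      exact isCInjective_of_retract hC (Y.cinj i) (q i) ρ hρ
    · exact isCInjective_of_isZero (hzero i hi)
  obtain ⟨hl, hl₀, hl₁⟩ := (extends_augment_iff _ _ _).1
    ((homInto_acyclic_iff _ _).1 (Y.proper J hJ))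
  refine (extends_augment_iff _ _ _).2 ⟨fun f => ?_, fun f hf => ?_, fun k f hf => ?_⟩
  · obtain ⟨g, hg⟩ := hl f
    exact ⟨q 0 ≫ g, by rw [reassoc_of% hqη, hg]⟩
  · obtain ⟨ρ, hρ⟩ := hret 0 (Nat.zero_le n)
    obtain ⟨g, hg⟩ := hl₀ (ρ ≫ f) (by rw [← hqη, Category.assoc, reassoc_of% hρ, hf])
    exact ⟨q 1 ≫ g, by rw [← reassoc_of% (hqd 0 1), hg, reassoc_of% hρ]⟩
  · rcases le_or_gt (k + 1) n with hk | hk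
    · obtain ⟨ρ, hρ⟩ := hret (k + 1) hk
      have := hqepi k hk
      -- Dually, the cocycle condition is tested after precomposing with `q k`, an epimorphism
      -- because `k < n`.
      obtain ⟨g, hg⟩ := hl₁ k (ρ ≫ f) (by
        rw [← cancel_epi (q k), reassoc_of% (hqd k (k + 1)), reassoc_of% hρ, hf, comp_zero])
      exact ⟨q (k + 2) ≫ g, by rw [← reassoc_of% (hqd (k + 1) (k + 2)), hg, reassoc_of% hρ]⟩
    · exact ⟨0, (hzero _ hk).eq_of_src _ _⟩

end Truncation

/-! ### Dimensions in terms of relative Ext. -/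

section Vanishing

variable {R : Type u} [CommRing R] {C : ModuleCat.{u} R}

theorem isZero_extProj_of_isZero {M : ModuleCat.{u} R} (X : ProperProjRes C M) {i : ℕ}
    (h : IsZero (X.complex.X i)) (N : ModuleCat.{u} R) : IsZero (extProj C M N i) := by
  obtain ⟨e⟩ := X.nonempty_extProj_iso N i
  refine IsZero.of_iso ?_ e
  rw [← HomologicalComplex.exactAt_iff_isZero_homology]
  refine ShortComplex.exact_of_isZero_X₂ _ ?_
  refine @ModuleCat.isZero_of_subsingleton _ _ _ ⟨fun a b => ?_⟩
  exact h.eq_of_src (Y := N) a b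

theorem isZero_extInj_of_isZero {N : ModuleCat.{u} R} (Y : ProperInjRes C N) {i : ℕ}
    (h : IsZero (Y.complex.X i)) (M : ModuleCat.{u} R) : IsZero (extInj C M N i) := by
  obtain ⟨e⟩ := Y.nonempty_extInj_iso M i
  refine IsZero.of_iso ?_ e
  rw [← HomologicalComplex.exactAt_iff_isZero_homology]
  refine ShortComplex.exact_of_isZero_X₂ _ ?_
  refine @ModuleCat.isZero_of_subsingleton _ _ _ ⟨fun a b => ?_⟩
  exact IsZero.eq_of_tgt (Y := M) h a b

theorem projDim_le_iff_isZero_extProj (hC : IsSemidualizing C) (M : ModuleCat.{u} R) (n : ℕ) :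
    projDim C M ≤ ((n : ℕ∞) : WithBot ℕ∞) ↔
      ∀ N : ModuleCat.{u} R, IsZero (extProj C M N (n + 1)) := by
  rw [projDim_le_iff]
  exact ⟨fun ⟨X, hX⟩ => isZero_extProj_of_isZero X (hX _ n.lt_succ_self),
    exists_properProjRes_of_isZero_extProj hC n⟩

theorem injDim_le_iff_isZero_extInj (hC : IsSemidualizing C) (N : ModuleCat.{u} R) (n : ℕ) :
    injDim C N ≤ ((n : ℕ∞) : WithBot ℕ∞) ↔
      ∀ M : ModuleCat.{u} R, IsZero (extInj C M N (n + 1)) := by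
  rw [injDim_le_iff]
  exact ⟨fun ⟨Y, hY⟩ => isZero_extInj_of_isZero Y (hY _ n.lt_succ_self),
    exists_properInjRes_of_isZero_extInj hC n⟩

/-- A proper resolution of finite length is automatically exact, and one of infinite length
contributes only `⊤` to the infimum. -/
theorem projDim_eq_exactProjDim (hC : IsSemidualizing C) (M : ModuleCat.{u} R) :
    projDim C M = exactProjDim C M := by
  refine le_antisymm (le_iInf₂ fun X _ => iInf_le _ X) (le_iInf fun X => ?_)
  by_cases h : ∃ n : ℕ, length X.complex ≤ ((n : ℕ∞) : WithBot ℕ∞)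
  · obtain ⟨n, hn⟩ := h
    exact iInf₂_le X ((forall_homFrom_acyclic_iff_acyclic hC _ _ _ X.cproj (n + 1)
      ((length_le_iff _ _).1 hn)).1 X.proper)
  · suffices length X.complex = ⊤ from this ▸ le_top
    generalize length X.complex = a at h
    induction a with
    | bot => exact absurd ⟨0, bot_le⟩ h
    | coe a =>
      induction a with
      | top => rfl
      | coe a => exact absurd ⟨a, le_rfl⟩ h

/-- As `X_1 = 0`, the identity of `X_0` is a cocycle of degree `0`. Nothing but zero is a coboundary
there, so `Ext^0 = 0` makes the identity zero. -/
theorem isZero_of_isZero_extProj_zero {M : ModuleCat.{u} R} (X : ProperProjRes C M)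
    (h1 : IsZero (X.complex.X 1)) (h : ∀ N : ModuleCat.{u} R, IsZero (extProj C M N 0)) :
    IsZero (X.complex.X 0) := by
  obtain ⟨e⟩ := X.nonempty_extProj_iso (X.complex.X 0) 0
  have hz : (homInto X.complex (X.complex.X 0)).ExactAt 0 := by
    rw [HomologicalComplex.exactAt_iff_isZero_homology]
    exact (h _).of_iso e.symm
  rw [HomologicalComplex.exactAt_iff' (homInto X.complex (X.complex.X 0)) 0 0 1
    (show (ComplexShape.down ℕ).next 0 = 0 by simp)
    (show (ComplexShape.down ℕ).prev 0 = 1 by simp),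
    ShortComplex.moduleCat_exact_iff] at hz
  obtain ⟨g, hg⟩ := hz (𝟙 (X.complex.X 0)) (h1.eq_of_src (Y := X.complex.X 0) _ _)
  refine (IsZero.iff_id_eq_zero _).2 ((show X.complex.d 0 0 ≫ _ = 𝟙 _ from hg).symm.trans ?_)
  rw [X.complex.shape 0 0 (by simp)]
  exact zero_comp

theorem extProjSup_le_iff (C M : ModuleCat.{u} R) (a : WithBot ℕ∞) :
    extProjSup C M ≤ a ↔ ∀ (n : ℕ) (N : ModuleCat.{u} R), ¬ IsZero (extProj C M N n) →
      ((n : ℕ∞) : WithBot ℕ∞) ≤ a := by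
  simp [extProjSup]

theorem projDim_eq_extProjSup (hC : IsSemidualizing C) (M : ModuleCat.{u} R) :
    projDim C M = extProjSup C M := by
  refine le_antisymm ?_ ((extProjSup_le_iff _ _ _).2 fun n N hN => le_iInf fun X => ?_)
  · have hle : ∀ n : ℕ, extProjSup C M ≤ ((n : ℕ∞) : WithBot ℕ∞) →
        projDim C M ≤ ((n : ℕ∞) : WithBot ℕ∞) := fun n hn => by
      rw [projDim_le_iff_isZero_extProj hC]
      intro N
      by_contra hN
      have := ((extProjSup_le_iff _ _ _).1 hn _ N hN)
      rw [WithBot.coe_le_coe, Nat.cast_le] at this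
      lia
    -- The value `-∞` is not reached by comparison with natural numbers. The bound `0` gives a
    -- resolution concentrated in degree `0`, and vanishing of `Ext^0` removes its remaining term.
    have hbot : extProjSup C M ≤ ⊥ → projDim C M ≤ ⊥ := fun hb => by
      obtain ⟨X, hX⟩ := (projDim_le_iff M 0).1 (hle 0 (hb.trans bot_le))
      have h0 := isZero_of_isZero_extProj_zero X (hX 1 one_pos) fun N => by
        by_contra hN
        exact absurd ((extProjSup_le_iff _ _ _).1 hb _ N hN) (by simp)
      refine (iInf_le _ X).trans (iSup₂_le fun i hi => absurd ?_ hi)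
      exact i.eq_zero_or_pos.elim (fun h => h ▸ h0) (hX i)
    generalize extProjSup C M = a at hle hbot
    induction a with
    | bot => exact hbot le_rfl
    | coe a =>
      induction a with
      | top => exact le_top
      | coe a => exact hle a le_rfl
  · have : ¬ IsZero (X.complex.X n) := fun h => hN (isZero_extProj_of_isZero X h N)
    exact le_iSup₂_of_le n this le_rfl

end Vanishing

end

end CRel

/-! ### The main theorem. -/

theorem mainTheorem1 {R : Type u} [CommRing R] (C : ModuleCat.{u} R)
    (hC : CRel.IsSemidualizing C) :
    (∀ (M : ModuleCat.{u} R) (n : ℕ),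
      CRel.projDim C M ≤ ((n : ℕ∞) : WithBot ℕ∞) ↔ CRel.HasProjSequence C M n) ∧
    (∀ (N : ModuleCat.{u} R) (n : ℕ),
      CRel.injDim C N ≤ ((n : ℕ∞) : WithBot ℕ∞) ↔ CRel.HasInjSequence C N n) ∧
    (∀ (M : ModuleCat.{u} R) (n : ℕ), List.TFAE
      [∀ N : ModuleCat.{u} R, CategoryTheory.Limits.IsZero (CRel.extProj C M N (n + 1)),
       ∀ i : ℕ, n + 1 ≤ i →
        ∀ N : ModuleCat.{u} R, CategoryTheory.Limits.IsZero (CRel.extProj C M N i),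
       CRel.projDim C M ≤ ((n : ℕ∞) : WithBot ℕ∞)]) ∧
    (∀ (N : ModuleCat.{u} R) (n : ℕ), List.TFAE
      [∀ M : ModuleCat.{u} R, CategoryTheory.Limits.IsZero (CRel.extInj C M N (n + 1)),
       ∀ i : ℕ, n + 1 ≤ i →
        ∀ M : ModuleCat.{u} R, CategoryTheory.Limits.IsZero (CRel.extInj C M N i),
       CRel.injDim C N ≤ ((n : ℕ∞) : WithBot ℕ∞)]) ∧
    (∀ M : ModuleCat.{u} R,
      CRel.projDim C M = CRel.exactProjDim C M ∧ CRel.projDim C M = CRel.extProjSup C M) := by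
  refine ⟨fun M n => (CRel.projDim_le_iff M n).trans (CRel.hasProjSequence_iff hC M n).symm,
    fun N n => (CRel.injDim_le_iff N n).trans (CRel.hasInjSequence_iff hC N n).symm,
    fun M n => ?_, fun N n => ?_,
    fun M => ⟨CRel.projDim_eq_exactProjDim hC M, CRel.projDim_eq_extProjSup hC M⟩⟩
  · tfae_have 1 → 3 := (CRel.projDim_le_iff_isZero_extProj hC M n).2
    tfae_have 3 → 2 := fun h i hi N => by
      obtain ⟨X, hX⟩ := (CRel.projDim_le_iff M n).1 h
      exact CRel.isZero_extProj_of_isZero X (hX i hi) N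
    tfae_have 2 → 1 := fun h => h _ le_rfl
    tfae_finish
  · tfae_have 1 → 3 := (CRel.injDim_le_iff_isZero_extInj hC N n).2
    tfae_have 3 → 2 := fun h i hi M => by
      obtain ⟨Y, hY⟩ := (CRel.injDim_le_iff N n).1 h
      exact CRel.isZero_extInj_of_isZero Y (hY i hi) M
    tfae_have 2 → 1 := fun h => h _ le_rfl
    tfae_finish
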